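/- Let $G$ be a locally compact Hausdorff group with left Haar measure $\nu$, and let $\Gamma\le G$ be a cocompact lattice, i.e. a discrete subgroup such that $G/\Gamma$ is compact and carries a nonzero finite $G$-invariant Radon measure $\mu$. For a unitary representation $\rho$ of $\Gamma$ on a complex Hilbert space $V$, let $\mathrm{Ind}_\Gamma^G\rho$ be the induced representation of $G$: its Hilbert space is the completion of the space of continuous functions $\varphi:G\to V$ with $\varphi(g\gamma)=\rho(\gamma)^{-1}\varphi(g)$ for all $g\in G$, $\gamma\in\Gamma$, with respect to $\langle\varphi,\psi\rangle=\int_{G/\Gamma}\langle\varphi(g),\psi(g)\rangle\,d\mu(g\Gamma)$, and $G$ acts by $(\pi(g)\varphi)(h)=\varphi(g^{-1}h)$. Let $\rho_i$ $(i\in\mathbb N)$ and $\rho_\infty$ be unitary representations of $\Gamma$ on arbitrary complex Hilbert spaces. Suppose that $\rho_i$ converges strongly to $\rho_\infty$, i.e. for every $z\in\mathbb C[\Gamma]$, $$\lim_{i\to\infty}\|\rho_i(z)\|=\|\rho_\infty(z)\|.$$ Then $\mathrm{Ind}_\Gamma^G\rho_i$ converges strongly to $\mathrm{Ind}_\Gamma^G\rho_\infty$,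 i.e. with $\pi_i=\mathrm{Ind}_\Gamma^G\rho_i$, $\pi_\infty=\mathrm{Ind}_\Gamma^G\rho_\infty$ and $\pi(f)=\int_G f(g)\,\pi(g)\,d\nu(g)$, for every continuous compactly supported $f:G\to\mathbb C$, $$\lim_{i\to\infty}\|\pi_i(f)\|=\|\pi_\infty(f)\|.$$ All norms are operator norms. -/

import Mathlib

open Filter Topology MeasureTheory
open scoped CompactlySupported

noncomputable section

namespace StrongInduction

/-! ### Unitary representations and strong convergence -/

section Discrete

variable {Γ : Type*} [Group Γ]
  {H : Type*} [NormedAddCommGroup H] [InnerProductSpace ℂ H] [CompleteSpace H]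

/-- For a unitary representation `ρ` of an abstract (discrete) group `Γ` and `z ∈ ℂ[Γ]`, the
bounded operator `ρ(z) = ∑_γ z(γ) ρ(γ)`. -/
def groupAlgebraOp (ρ : Γ →* unitary (H →L[ℂ] H)) (z : MonoidAlgebra ℂ Γ) : H →L[ℂ] H :=
  MonoidAlgebra.lift ℂ (H →L[ℂ] H) Γ ((unitary (H →L[ℂ] H)).subtype.comp ρ) z

/-- Strong convergence `ρ_i → ρ_∞` of unitary representations of a discrete group:
`‖ρ_i(z)‖ → ‖ρ_∞(z)‖` (operator norms) for all `z ∈ ℂ[Γ]`. -/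
def StronglyConverges
    {K : ℕ → Type*} [∀ i, NormedAddCommGroup (K i)] [∀ i, InnerProductSpace ℂ (K i)]
    [∀ i, CompleteSpace (K i)]
    (ρ : ∀ i, Γ →* unitary (K i →L[ℂ] K i)) (ρinf : Γ →* unitary (H →L[ℂ] H)) : Prop :=
  ∀ z : MonoidAlgebra ℂ Γ,
    Tendsto (fun i => ‖groupAlgebraOp (ρ i) z‖) atTop (𝓝 ‖groupAlgebraOp ρinf z‖)

end Discrete

/-- A (strongly continuous) unitary representation of a topological group `G` on a Hilbert
space `H`. -/
structure UnitaryRep (G : Type*) [Group G] [TopologicalSpace G]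
    (H : Type*) [NormedAddCommGroup H] [InnerProductSpace ℂ H] [CompleteSpace H] where
  /-- the underlying homomorphism to the unitary group of `H` -/
  toHom : G →* unitary (H →L[ℂ] H)
  /-- all orbit maps are continuous -/
  continuous_orbit : ∀ v : H, Continuous fun g => (toHom g : H →L[ℂ] H) v

section LocallyCompact

variable {G : Type*} [Group G] [TopologicalSpace G]
  {H : Type*} [NormedAddCommGroup H] [InnerProductSpace ℂ H] [CompleteSpace H]

theorem UnitaryRep.integrable_smul [MeasurableSpace G] [BorelSpace G]
    (ν : Measure G) [IsFiniteMeasureOnCompacts ν] (π : UnitaryRep G H) (f : C_c(G, ℂ)) (v : H) :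
    Integrable (fun g => f g • (π.toHom g : H →L[ℂ] H) v) ν := by
  refine Continuous.integrable_of_hasCompactSupport
    (f.continuous.smul (π.continuous_orbit v)) ?_
  exact f.hasCompactSupport.smul_right

/-- For `f ∈ C_c(G)`, the bounded operator `π(f) v = ∫_G f(g) π(g) v dν(g)`. -/
def UnitaryRep.op [MeasurableSpace G] [BorelSpace G]
    (ν : Measure G) [IsFiniteMeasureOnCompacts ν] (π : UnitaryRep G H) (f : C_c(G, ℂ)) :
    H →L[ℂ] H :=
  LinearMap.mkContinuous
    { toFun := fun v => ∫ g, f g • (π.toHom g : H →L[ℂ] H) v ∂ν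
      map_add' := fun v w => by
        rw [← integral_add (π.integrable_smul ν f v) (π.integrable_smul ν f w)]
        simp only [map_add, smul_add]
      map_smul' := fun c v => by
        simp only [map_smul, RingHom.id_apply]
        rw [← integral_smul]
        simp only [smul_comm c] }
    (∫ g, ‖f g‖ ∂ν)
    (fun v => by
      refine (norm_integral_le_integral_norm _).trans_eq ?_
      rw [← integral_mul_const]
      simp only [norm_smul, Unitary.norm_map])

/-- Strong convergence `π_i → π_∞` of unitary representations of a locally compact group `G` with
Haar measure `ν`: `‖π_i(f)‖ → ‖π_∞(f)‖` (operator norms) for all `f ∈ C_c(G)`. -/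
def UnitaryRep.StronglyConverges [MeasurableSpace G] [BorelSpace G]
    (ν : Measure G) [IsFiniteMeasureOnCompacts ν]
    {K : ℕ → Type*} [∀ i, NormedAddCommGroup (K i)] [∀ i, InnerProductSpace ℂ (K i)]
    [∀ i, CompleteSpace (K i)]
    (π : ∀ i, UnitaryRep G (K i)) (πinf : UnitaryRep G H) : Prop :=
  ∀ f : C_c(G, ℂ), Tendsto (fun i => ‖(π i).op ν f‖) atTop (𝓝 ‖πinf.op ν f‖)

end LocallyCompact

/-! ### Induced representations (compact quotient) -/

section Induced

variable {G : Type*} [Group G] [TopologicalSpace G] (Γ : Subgroup G)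
  {V : Type*} [NormedAddCommGroup V] [InnerProductSpace ℂ V] [CompleteSpace V]

/-- The space of continuous functions `φ : G → V` with `φ (g γ) = ρ(γ)⁻¹ φ(g)`. -/
def equivariantMaps (ρ : Γ →* unitary (V →L[ℂ] V)) : Submodule ℂ C(G, V) where
  carrier := {φ | ∀ (g : G) (γ : Γ), φ (g * γ) = (ρ γ⁻¹ : V →L[ℂ] V) (φ g)}
  add_mem' := fun {φ ψ} hφ hψ g γ => by simp [hφ g γ, hψ g γ]
  zero_mem' := fun g γ => by simp
  smul_mem' := fun c φ hφ g γ => by simp [hφ g γ]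

/-- The same space as `equivariantMaps Γ ρ`, as a type of its own; it carries the `L²` seminorm
over `G ⧸ Γ` with respect to `μ` introduced below. -/
def IndPre [MeasurableSpace (G ⧸ Γ)] (_μ : Measure (G ⧸ Γ))
    (ρ : Γ →* unitary (V →L[ℂ] V)) : Type _ :=
  equivariantMaps Γ ρ

namespace IndPre

variable [MeasurableSpace (G ⧸ Γ)] (μ : Measure (G ⧸ Γ)) (ρ : Γ →* unitary (V →L[ℂ] V))

instance : AddCommGroup (IndPre Γ μ ρ) := inferInstanceAs (AddCommGroup (equivariantMaps Γ ρ))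

instance : Module ℂ (IndPre Γ μ ρ) := inferInstanceAs (Module ℂ (equivariantMaps Γ ρ))

variable {Γ μ ρ}

/-- The underlying continuous function `G → V`. -/
def toMap (φ : IndPre Γ μ ρ) : C(G, V) := Subtype.val (p := (· ∈ equivariantMaps Γ ρ)) φ

/-- An equivariant continuous function as an element of `IndPre`. -/
def mk (φ : C(G, V)) (hφ : φ ∈ equivariantMaps Γ ρ) : IndPre Γ μ ρ :=
  (⟨φ, hφ⟩ : equivariantMaps Γ ρ)

theorem ext {φ ψ : IndPre Γ μ ρ} (h : ∀ g, φ.toMap g = ψ.toMap g) : φ = ψ :=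
  Subtype.ext (ContinuousMap.ext h)

@[simp] theorem toMap_mk (φ : C(G, V)) (hφ : φ ∈ equivariantMaps Γ ρ) :
    (mk φ hφ : IndPre Γ μ ρ).toMap = φ := rfl

@[simp] theorem toMap_add (φ ψ : IndPre Γ μ ρ) : (φ + ψ).toMap = φ.toMap + ψ.toMap := rfl

@[simp] theorem toMap_sub (φ ψ : IndPre Γ μ ρ) : (φ - ψ).toMap = φ.toMap - ψ.toMap := rfl

@[simp] theorem toMap_smul (c : ℂ) (φ : IndPre Γ μ ρ) : (c • φ).toMap = c • φ.toMap := rfl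

theorem toMap_mul (φ : IndPre Γ μ ρ) (g : G) (γ : Γ) :
    φ.toMap (g * γ) = (ρ γ⁻¹ : V →L[ℂ] V) (φ.toMap g) :=
  (Subtype.property (p := (· ∈ equivariantMaps Γ ρ)) φ) g γ

/-- The function `gΓ ↦ ⟪φ(g), ψ(g)⟫` on `G ⧸ Γ`. -/
def fiberInner (φ ψ : IndPre Γ μ ρ) : G ⧸ Γ → ℂ :=
  Quotient.lift (fun g => inner ℂ (φ.toMap g) (ψ.toMap g)) (fun a b hab => by
    have h : a⁻¹ * b ∈ Γ := QuotientGroup.leftRel_apply.mp hab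
    have hb : b = a * (⟨a⁻¹ * b, h⟩ : Γ) := by simp
    rw [hb, toMap_mul, toMap_mul, Unitary.inner_map_map])

@[simp] theorem fiberInner_mk (φ ψ : IndPre Γ μ ρ) (g : G) :
    fiberInner φ ψ (g : G ⧸ Γ) = inner ℂ (φ.toMap g) (ψ.toMap g) := rfl

theorem continuous_fiberInner (φ ψ : IndPre Γ μ ρ) : Continuous (fiberInner φ ψ) :=
  continuous_quot_lift _ (φ.toMap.continuous.inner ψ.toMap.continuous)

variable [CompactSpace (G ⧸ Γ)] [BorelSpace (G ⧸ Γ)] [IsFiniteMeasure μ]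

theorem integrable_fiberInner (φ ψ : IndPre Γ μ ρ) : Integrable (fiberInner φ ψ) μ :=
  (continuous_fiberInner φ ψ).integrable_of_hasCompactSupport
    (HasCompactSupport.of_compactSpace _)

variable (Γ μ ρ)

/-- The inner product `⟪φ, ψ⟫ = ∫_{G ⧸ Γ} ⟪φ(g), ψ(g)⟫ dμ(gΓ)`. -/
@[reducible] def core : PreInnerProductSpace.Core ℂ (IndPre Γ μ ρ) where
  inner φ ψ := ∫ x, fiberInner φ ψ x ∂μ
  conj_inner_symm φ ψ := by
    rw [← integral_conj]
    congr 1
    ext x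
    induction x using QuotientGroup.induction_on with
    | H g => simp
  re_inner_nonneg φ := by
    have h : ∀ x, 0 ≤ RCLike.re (fiberInner φ φ x) := fun x => by
      induction x using QuotientGroup.induction_on with
      | H g => simpa using inner_self_nonneg (𝕜 := ℂ) (x := φ.toMap g)
    rw [← integral_re (integrable_fiberInner φ φ)]
    exact integral_nonneg h
  add_left φ ψ χ := by
    rw [← integral_add (integrable_fiberInner φ χ) (integrable_fiberInner ψ χ)]
    congr 1
    ext x
    induction x using QuotientGroup.induction_on with
    | H g => simp
  smul_left φ ψ c := by
    rw [← integral_const_mul]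
    congr 1
    ext x
    induction x using QuotientGroup.induction_on with
    | H g => simp [mul_comm]

instance : SeminormedAddCommGroup (IndPre Γ μ ρ) :=
  @InnerProductSpace.Core.toSeminormedAddCommGroup ℂ (IndPre Γ μ ρ) _ _ _ (core Γ μ ρ)

instance : InnerProductSpace ℂ (IndPre Γ μ ρ) := InnerProductSpace.ofCore (core Γ μ ρ)

variable {Γ μ ρ}

theorem inner_def (φ ψ : IndPre Γ μ ρ) : inner ℂ φ ψ = ∫ x, fiberInner φ ψ x ∂μ := rfl

theorem norm_le_of_forall (φ : IndPre Γ μ ρ) {C : ℝ} (hC : 0 ≤ C)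
    (h : ∀ g, ‖φ.toMap g‖ ≤ C) : ‖φ‖ ≤ C * √(μ.real Set.univ) := by
  have h1 : ∀ x, ‖fiberInner φ φ x‖ ≤ C ^ 2 := fun x => by
    induction x using QuotientGroup.induction_on with
    | H g =>
      rw [fiberInner_mk, inner_self_eq_norm_sq_to_K, norm_pow]
      simpa using pow_le_pow_left₀ (norm_nonneg _) (h g) 2
  have h2 : ‖φ‖ ^ 2 ≤ C ^ 2 * μ.real Set.univ := by
    have h3 : ‖(inner ℂ φ φ : ℂ)‖ ≤ C ^ 2 * μ.real Set.univ :=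
      norm_integral_le_of_norm_le_const (Eventually.of_forall h1)
    rwa [inner_self_eq_norm_sq_to_K, norm_pow, RCLike.norm_ofReal, abs_norm] at h3
  refine abs_le_of_sq_le_sq' ?_ (by positivity) |>.2
  rwa [mul_pow, Real.sq_sqrt measureReal_nonneg]

variable [IsTopologicalGroup G] [SMulInvariantMeasure G (G ⧸ Γ) μ]

variable (Γ μ ρ) in
/-- Left translation `(T_g φ)(h) = φ(g⁻¹ h)`, a linear isometry for the `L²` seminorm. -/
def translate (g : G) : IndPre Γ μ ρ →ₗᵢ[ℂ] IndPre Γ μ ρ :=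
  LinearMap.isometryOfInner
    { toFun := fun φ => mk (φ.toMap.comp ⟨fun h => g⁻¹ * h, continuous_const_mul g⁻¹⟩)
        (fun h γ => by simp [← mul_assoc, toMap_mul])
      map_add' := fun φ ψ => rfl
      map_smul' := fun c φ => rfl }
    (fun φ ψ => by
      rw [inner_def, inner_def, ← integral_smul_eq_self (fiberInner φ ψ) (g := g⁻¹)]
      congr 1
      ext x
      induction x using QuotientGroup.induction_on with
      | H h => rfl)

@[simp] theorem translate_toMap (g : G) (φ : IndPre Γ μ ρ) (h : G) :
    (translate Γ μ ρ g φ).toMap h = φ.toMap (g⁻¹ * h) := rfl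

theorem translate_translate (g g' : G) (φ : IndPre Γ μ ρ) :
    translate Γ μ ρ g (translate Γ μ ρ g' φ) = translate Γ μ ρ (g * g') φ :=
  ext fun h => by simp [mul_assoc]

theorem translate_one (φ : IndPre Γ μ ρ) : translate Γ μ ρ 1 φ = φ :=
  ext fun h => by simp

theorem continuous_translate (φ : IndPre Γ μ ρ) :
    Continuous fun g => translate Γ μ ρ g φ := by
  rw [continuous_iff_continuousAt]
  intro g₀
  rw [ContinuousAt, tendsto_iff_norm_sub_tendsto_zero]
  have key : ∀ ε > 0, ∀ᶠ g in 𝓝 g₀, ∀ h : G, ‖φ.toMap (g⁻¹ * h) - φ.toMap (g₀⁻¹ * h)‖ ≤ ε := by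
    intro ε hε
    have h1 : ∀ᶠ g in 𝓝 g₀, ∀ y ∈ (Set.univ : Set (G ⧸ Γ)),
        ∀ h : G, (h : G ⧸ Γ) = y → ‖φ.toMap (g⁻¹ * h) - φ.toMap (g₀⁻¹ * h)‖ ≤ ε := by
      refine isCompact_univ.eventually_forall_of_forall_eventually fun y _ => ?_
      induction y using QuotientGroup.induction_on with
      | H h₀ =>
        have hq : IsOpenQuotientMap (Prod.map id ((↑) : G → G ⧸ Γ) : G × G → G × (G ⧸ Γ)) :=
          IsOpenQuotientMap.id.prodMap QuotientGroup.isOpenQuotientMap_mk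
        have hn := hq.map_nhds_eq (g₀, h₀)
        simp only [Prod.map_apply, id_eq] at hn
        rw [← hn, eventually_map]
        have hc : Continuous fun z : G × G =>
            ‖φ.toMap (z.1⁻¹ * z.2) - φ.toMap (g₀⁻¹ * z.2)‖ := by fun_prop
        have h2 : ∀ᶠ z : G × G in 𝓝 (g₀, h₀),
            ‖φ.toMap (z.1⁻¹ * z.2) - φ.toMap (g₀⁻¹ * z.2)‖ < ε :=
          hc.continuousAt.eventually_lt continuousAt_const (by simpa using hε)
        filter_upwards [h2] with z hz h hh
        have h3 : z.2⁻¹ * h ∈ Γ := QuotientGroup.eq.mp hh.symm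
        obtain ⟨γ, rfl⟩ : ∃ γ : Γ, h = z.2 * γ := ⟨⟨z.2⁻¹ * h, h3⟩, by simp⟩
        simp only [Prod.map_fst, id_eq]
        rw [ ← mul_assoc, ← mul_assoc, toMap_mul, toMap_mul, ← map_sub, Unitary.norm_map]
        exact hz.le
    filter_upwards [h1] with g hg h using hg _ (Set.mem_univ _) h rfl
  have key2 : ∀ ε > 0, ∀ᶠ g in 𝓝 g₀,
      ‖translate Γ μ ρ g φ - translate Γ μ ρ g₀ φ‖ ≤ ε * √(μ.real Set.univ) := by
    intro ε hε
    filter_upwards [key ε hε] with g hg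
    exact norm_le_of_forall _ hε.le fun h => by simpa using hg h
  rw [Metric.tendsto_nhds]
  intro ε hε
  have hM : 0 < √(μ.real Set.univ) + 1 := by positivity
  filter_upwards [key2 (ε / (√(μ.real Set.univ) + 1)) (by positivity)] with g hg
  rw [Real.dist_eq, sub_zero, abs_norm]
  refine hg.trans_lt ?_
  rw [div_mul_eq_mul_div, div_lt_iff₀ hM]
  nlinarith

end IndPre

variable [IsTopologicalGroup G] [MeasurableSpace (G ⧸ Γ)] [BorelSpace (G ⧸ Γ)]
  [CompactSpace (G ⧸ Γ)]
  (μ : Measure (G ⧸ Γ)) [IsFiniteMeasure μ] [SMulInvariantMeasure G (G ⧸ Γ) μ]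
  (ρ : Γ →* unitary (V →L[ℂ] V))

/-- The Hilbert space of the induced representation: the `L²` completion of the space of
continuous equivariant functions. -/
abbrev IndSpace : Type _ := UniformSpace.Completion (IndPre Γ μ ρ)

/-- The unitary operator of translation by `g` on `IndSpace`, extending `IndPre.translate`. -/
def indIso (g : G) : IndSpace Γ μ ρ ≃ₗᵢ[ℂ] IndSpace Γ μ ρ where
  toFun := (IndPre.translate Γ μ ρ g).toContinuousLinearMap.completion
  invFun := (IndPre.translate Γ μ ρ g⁻¹).toContinuousLinearMap.completion
  map_add' := map_add _
  map_smul' := map_smul _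
  left_inv v := by
    induction v using UniformSpace.Completion.induction_on with
    | hp => exact isClosed_eq (by fun_prop) continuous_id
    | ih φ => simp [IndPre.translate_translate, IndPre.translate_one]
  right_inv v := by
    induction v using UniformSpace.Completion.induction_on with
    | hp => exact isClosed_eq (by fun_prop) continuous_id
    | ih φ => simp [IndPre.translate_translate, IndPre.translate_one]
  norm_map' v := by
    induction v using UniformSpace.Completion.induction_on with
    | hp => exact isClosed_eq (by dsimp; fun_prop) continuous_norm
    | ih φ => simp

@[simp] theorem indIso_coe (g : G) (φ : IndPre Γ μ ρ) :
    indIso Γ μ ρ g (φ : IndSpace Γ μ ρ) = (IndPre.translate Γ μ ρ g φ : IndPre Γ μ ρ) :=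
  ContinuousLinearMap.completion_apply_coe _ φ

theorem continuous_indIso (v : IndSpace Γ μ ρ) : Continuous fun g => indIso Γ μ ρ g v := by
  rw [Metric.continuous_iff']
  intro g₀ ε hε
  obtain ⟨φ, hφ⟩ : ∃ φ : IndPre Γ μ ρ, dist v (φ : IndSpace Γ μ ρ) < ε / 3 :=
    (UniformSpace.Completion.denseRange_coe).exists_dist_lt v (by positivity)
  have hc : Continuous fun g => ((IndPre.translate Γ μ ρ g φ : IndPre Γ μ ρ) : IndSpace Γ μ ρ) :=
    (UniformSpace.Completion.continuous_coe _).comp (IndPre.continuous_translate φ)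
  filter_upwards [Metric.continuous_iff'.mp hc g₀ (ε / 3) (by positivity)] with g hg
  have h1 : dist (indIso Γ μ ρ g v) (indIso Γ μ ρ g φ) < ε / 3 := by
    rwa [LinearIsometryEquiv.dist_map]
  have h2 : dist (indIso Γ μ ρ g₀ φ) (indIso Γ μ ρ g₀ v) < ε / 3 := by
    rwa [LinearIsometryEquiv.dist_map, dist_comm]
  rw [← indIso_coe, ← indIso_coe] at hg
  have h3 := dist_triangle4 (indIso Γ μ ρ g v) (indIso Γ μ ρ g φ) (indIso Γ μ ρ g₀ φ)
    (indIso Γ μ ρ g₀ v)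
  linarith

/-- The induced representation `Ind_Γ^G ρ` (for `G ⧸ Γ` compact with a finite invariant measure
`μ`), on the `L²` completion of the continuous functions `φ : G → V` with
`φ(gγ) = ρ(γ)⁻¹ φ(g)`, acting by `(π(g)φ)(h) = φ(g⁻¹h)`. -/
def Ind : UnitaryRep G (IndSpace Γ μ ρ) where
  toHom :=
    MonoidHom.comp (Unitary.linearIsometryEquiv (𝕜 := ℂ) (H := IndSpace Γ μ ρ)).symm.toMonoidHom
    { toFun := indIso Γ μ ρ
      map_one' := by
        ext v
        induction v using UniformSpace.Completion.induction_on with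
        | hp => exact isClosed_eq (LinearIsometryEquiv.continuous _) continuous_id
        | ih φ => simp [IndPre.translate_one]
      map_mul' := fun g g' => by
        ext v
        induction v using UniformSpace.Completion.induction_on with
        | hp => exact isClosed_eq (LinearIsometryEquiv.continuous _)
                  (LinearIsometryEquiv.continuous _)
        | ih φ => simp [IndPre.translate_translate] }
  continuous_orbit := continuous_indIso Γ μ ρ

@[simp] theorem Ind_apply_coe (g : G) (φ : IndPre Γ μ ρ) :
    ((Ind Γ μ ρ).toHom g : IndSpace Γ μ ρ →L[ℂ] IndSpace Γ μ ρ) (φ : IndSpace Γ μ ρ)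
      = (IndPre.translate Γ μ ρ g φ : IndPre Γ μ ρ) :=
  indIso_coe Γ μ ρ g φ

end Induced

end StrongInduction

end

/-!
Convolution by `F` on the representation induced from `ρ` is an integral operator with kernel
`(x, y) ↦ ρ(F_{x,y})`, where `F_{x,y} = ∑ F(xγy⁻¹) γ` lies in `ℂ[Γ]` and is determined, up to left
and right multiplication by elements of `Γ`, by its values for `(x, y)` in a compact set. There the
`F_{x,y}` form a continuous family with supports in one finite set, so that strong convergence makes
`N_{ρᵢ}(F) = sup ‖ρᵢ(F_{x,y})‖` converge to `N_{ρ∞}(F)`.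

The operator norm of `π(F)` itself is at most `C N_ρ(F)`, and conversely
`N_ρ(g * F * g) ≤ D ‖π(F)‖`, since `g` smooths an `L²` vector into a bounded continuous one.
For self-adjoint `T = π(g)` and `F` the `(n + 1)`-st convolution power of `g` these estimates give
`‖T‖ⁿ⁺³ ≤ C N_ρ(g * F * g) ≤ C D ‖T‖ⁿ⁺¹` with `C` and `D` independent of `n` and of `ρ`, and letting
`n → ∞` after `i → ∞` yields `‖πᵢ(g)‖ → ‖π∞(g)‖`. For general `f` apply this to the function `g`
with `π(g) = π(f)* π(f)`.
-/

noncomputable section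

namespace StrongInduction

section PowerBounds

theorem norm_pow_of_isSelfAdjoint {A : Type*} [NormedRing A] [StarRing A] [CStarRing A] {x : A}
    (hx : IsSelfAdjoint x) {n : ℕ} (hn : n ≠ 0) : ‖x ^ n‖ = ‖x‖ ^ n := by
  refine le_antisymm (norm_pow_le' x (Nat.pos_of_ne_zero hn)) ?_
  rcases eq_or_ne x 0 with rfl | h0
  · simp [hn]
  have hpos : 0 < ‖x‖ := norm_pos_iff.mpr h0
  have hlt : n < 2 ^ n := Nat.lt_two_pow_self
  refine le_of_mul_le_mul_right ?_ (pow_pos hpos (2 ^ n - n))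
  calc ‖x‖ ^ n * ‖x‖ ^ (2 ^ n - n) = ‖x ^ n * x ^ (2 ^ n - n)‖ := by
        rw [← pow_add, ← pow_add, Nat.add_sub_of_le hlt.le, hx.norm_pow_two_pow]
    _ ≤ ‖x ^ n‖ * ‖x‖ ^ (2 ^ n - n) := (norm_mul_le _ _).trans
        (mul_le_mul_of_nonneg_left (norm_pow_le' x (Nat.sub_pos_of_lt hlt)) (norm_nonneg _))

theorem exists_mul_pow_lt_pow_add_two {C s t : ℝ} (hs : 0 ≤ s) (hst : s < t) :
    ∃ n : ℕ, C * s ^ (n + 1) < t ^ (n + 3) := by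
  have ht : 0 < t := hs.trans_lt hst
  have htendsto : Tendsto (fun n : ℕ => C * s * (s / t) ^ n) atTop (𝓝 (C * s * 0)) :=
    (tendsto_pow_atTop_nhds_zero_of_lt_one (by positivity) ((div_lt_one ht).mpr hst)).const_mul _
  obtain ⟨n, hn⟩ := (htendsto.eventually_lt_const (by simpa using pow_pos ht 3)).exists
  refine ⟨n, ?_⟩
  calc C * s ^ (n + 1) = C * s * (s / t) ^ n * t ^ n := by
        rw [div_pow]; field_simp; ring
    _ < t ^ 3 * t ^ n := mul_lt_mul_of_pos_right hn (pow_pos ht n)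
    _ = t ^ (n + 3) := by ring

/- Taking `n`-th roots makes the constants disappear as `n → ∞`. -/
theorem tendsto_of_pow_le_of_le_pow {ι : Type*} {l : Filter ι} {a : ι → ℝ} {b C D C' D' : ℝ}
    {N : ℕ → ι → ℝ} {N' : ℕ → ℝ} (ha : ∀ i, 0 ≤ a i) (hb : 0 ≤ b) (hC : 0 ≤ C) (hD : 0 ≤ D)
    (hC' : 0 ≤ C') (hN : ∀ n, Tendsto (N n) l (𝓝 (N' n)))
    (hle : ∀ n i, a i ^ (n + 3) ≤ C * N n i) (hge : ∀ n i, N n i ≤ D * a i ^ (n + 1))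
    (hle' : ∀ n, b ^ (n + 3) ≤ C' * N' n) (hge' : ∀ n, N' n ≤ D' * b ^ (n + 1)) :
    Tendsto a l (𝓝 b) := by
  refine tendsto_order.mpr ⟨fun t ht => ?_, fun t ht => ?_⟩
  · rcases lt_or_ge t 0 with ht0 | ht0
    · exact Eventually.of_forall fun i => ht0.trans_le (ha i)
    obtain ⟨n, hn⟩ := exists_mul_pow_lt_pow_add_two (C := C' * D) ht0 ht
    filter_upwards [((hN n).const_mul C').eventually_const_lt (hn.trans_le (hle' n))] with i hi
    by_contra! hit
    refine hi.not_ge ?_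
    calc C' * N n i ≤ C' * (D * a i ^ (n + 1)) := mul_le_mul_of_nonneg_left (hge n i) hC'
      _ ≤ C' * (D * t ^ (n + 1)) := by have := ha i; gcongr
      _ = C' * D * t ^ (n + 1) := (mul_assoc _ _ _).symm
  · obtain ⟨n, hn⟩ := exists_mul_pow_lt_pow_add_two (C := C * D') hb ht
    have hlim : C * N' n < t ^ (n + 3) :=
      (mul_le_mul_of_nonneg_left (hge' n) hC).trans_lt (by rwa [← mul_assoc])
    filter_upwards [((hN n).const_mul C).eventually_lt_const hlim] with i hi
    exact lt_of_pow_lt_pow_left₀ (n + 3) (hb.trans ht.le) ((hle n i).trans_lt hi)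

end PowerBounds

section Convolution

variable {G : Type*} [Group G] [TopologicalSpace G] [IsTopologicalGroup G] [MeasurableSpace G]
  [BorelSpace G] {E : Type*} [NormedAddCommGroup E] [NormedSpace ℂ E]

theorem integrable_smul_comp_inv_mul (σ : Measure G) [IsFiniteMeasureOnCompacts σ] (f : C_c(G, ℂ))
    (φ : C(G, E)) (x : G) : Integrable (fun y => f y • φ (y⁻¹ * x)) σ :=
  Continuous.integrable_of_hasCompactSupport
    (f.continuous.smul (φ.continuous.comp (continuous_inv.mul continuous_const)))
    f.hasCompactSupport.smul_right

/-- The convolution `x ↦ ∫ f(y) φ(y⁻¹x) dσ(y)` of a continuous map `φ` by a compactly supported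
function `f`. The measure `σ` is arbitrary because both Haar measure and its inverse occur. -/
def smear (σ : Measure G) [IsFiniteMeasureOnCompacts σ] (f : C_c(G, ℂ)) (φ : C(G, E)) :
    C(G, E) where
  toFun x := ∫ y, f y • φ (y⁻¹ * x) ∂σ
  continuous_toFun := by
    rw [← continuousOn_univ]
    refine continuousOn_integral_of_compact_support (k := tsupport f) f.hasCompactSupport
      (Continuous.continuousOn ?_) fun x y _ hy => ?_
    · have := f.continuous
      simp only [Function.uncurry_def]
      fun_prop
    · rw [image_eq_zero_of_notMem_tsupport hy, zero_smul]

theorem smear_apply (σ : Measure G) [IsFiniteMeasureOnCompacts σ] (f : C_c(G, ℂ)) (φ : C(G, E))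
    (x : G) : smear σ f φ x = ∫ y, f y • φ (y⁻¹ * x) ∂σ := rfl

omit [MeasurableSpace G] [BorelSpace G] in
theorem hasCompactSupport_smul_comp_inv_mul (f u : C_c(G, ℂ)) :
    HasCompactSupport fun z : G × G => f z.2 • u (z.2⁻¹ * z.1) := by
  refine HasCompactSupport.intro ((f.hasCompactSupport.isCompact.mul
    u.hasCompactSupport.isCompact).prod f.hasCompactSupport.isCompact) fun z hz => ?_
  by_cases hy : z.2 ∈ tsupport f
  · have hu : z.2⁻¹ * z.1 ∉ tsupport u := fun h => hz ⟨⟨z.2, hy, z.2⁻¹ * z.1, h, by simp⟩, hy⟩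
    rw [image_eq_zero_of_notMem_tsupport hu, smul_zero]
  · rw [image_eq_zero_of_notMem_tsupport hy, zero_smul]

/-- The convolution `f * u` of compactly supported functions with respect to a measure `σ`. -/
def conv (σ : Measure G) [IsFiniteMeasureOnCompacts σ] (f u : C_c(G, ℂ)) : C_c(G, ℂ) where
  toContinuousMap := smear σ f u.toContinuousMap
  hasCompactSupport' := by
    refine HasCompactSupport.intro
      ((hasCompactSupport_smul_comp_inv_mul f u).isCompact.image continuous_fst) fun x hx => ?_
    refine integral_eq_zero_of_ae (Eventually.of_forall fun y => ?_)
    by_contra h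
    exact hx ⟨(x, y), subset_tsupport _ h, rfl⟩

theorem conv_apply (σ : Measure G) [IsFiniteMeasureOnCompacts σ] (f u : C_c(G, ℂ)) (x : G) :
    conv σ f u x = ∫ y, f y • u (y⁻¹ * x) ∂σ := rfl

/-- The powers `g, g * g, g * (g * g), …` for convolution; `convPow ν g n` is the `(n + 1)`-st. -/
def convPow (ν : Measure G) [IsFiniteMeasureOnCompacts ν] (g : C_c(G, ℂ)) : ℕ → C_c(G, ℂ)
  | 0 => g
  | n + 1 => conv ν g (convPow ν g n)

omit [MeasurableSpace G] [BorelSpace G] in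
/-- The function `f^♯(x) = conj f(x⁻¹)`, whose operator with respect to the inverted measure is the
adjoint of that of `f`. Inverting the measure replaces the modular function in the usual
involution on `L¹`. -/
def conjInv (f : C_c(G, ℂ)) : C_c(G, ℂ) where
  toFun x := star (f x⁻¹)
  continuous_toFun := (f.continuous.comp continuous_inv).star
  hasCompactSupport' :=
    (f.hasCompactSupport.comp_homeomorph (Homeomorph.inv G)).comp_left (g := star) (star_zero ℂ)

omit [MeasurableSpace G] [BorelSpace G] in
theorem conjInv_apply (f : C_c(G, ℂ)) (x : G) : conjInv f x = star (f x⁻¹) := rfl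

end Convolution

namespace UnitaryRep

variable {G : Type*} [Group G] [TopologicalSpace G] [MeasurableSpace G] [BorelSpace G]
  {H : Type*} [NormedAddCommGroup H] [InnerProductSpace ℂ H] [CompleteSpace H]
  (π : UnitaryRep G H)

theorem op_apply (σ : Measure G) [IsFiniteMeasureOnCompacts σ] (f : C_c(G, ℂ)) (v : H) :
    π.op σ f v = ∫ g, f g • (π.toHom g : H →L[ℂ] H) v ∂σ := rfl

variable [IsTopologicalGroup G]

theorem op_conv (σ ν : Measure G) [IsFiniteMeasureOnCompacts σ] [IsFiniteMeasureOnCompacts ν]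
    [ν.IsMulLeftInvariant] (f u : C_c(G, ℂ)) :
    π.op ν (conv σ f u) = π.op σ f * π.op ν u := by
  ext v
  rw [mul_apply_eq_comp, op_apply, op_apply, op_apply]
  calc ∫ x, conv σ f u x • (π.toHom x : H →L[ℂ] H) v ∂ν
      = ∫ x, ∫ y, (f y • u (y⁻¹ * x)) • (π.toHom x : H →L[ℂ] H) v ∂σ ∂ν := by
        simp only [conv_apply, integral_smul_const]
    _ = ∫ y, ∫ x, (f y • u (y⁻¹ * x)) • (π.toHom x : H →L[ℂ] H) v ∂ν ∂σ := by
        have hfu : HasCompactSupport (Function.uncurry fun x y =>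
            (f y • u (y⁻¹ * x)) • (π.toHom x : H →L[ℂ] H) v) := by
          simp only [Function.uncurry_def]
          exact (hasCompactSupport_smul_comp_inv_mul f u).smul_right
        refine integral_integral_swap_of_hasCompactSupport ?_ hfu
        have := f.continuous
        have := u.continuous
        have hπ : Continuous fun z : G × G => (π.toHom z.1 : H →L[ℂ] H) v :=
          (π.continuous_orbit v).comp continuous_fst
        simp only [Function.uncurry_def]
        fun_prop
    _ = ∫ y, f y • (π.toHom y : H →L[ℂ] H) (∫ x, u x • (π.toHom x : H →L[ℂ] H) v ∂ν) ∂σ := by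
        congr 1 with y
        rw [← integral_mul_left_eq_self _ y,
          ← ContinuousLinearMap.integral_comp_comm _ (π.integrable_smul ν u v), ← integral_smul]
        congr 1 with x
        simp [smul_smul]

theorem op_convPow (ν : Measure G) [IsFiniteMeasureOnCompacts ν] [ν.IsMulLeftInvariant]
    (g : C_c(G, ℂ)) (n : ℕ) : π.op ν (convPow ν g n) = π.op ν g ^ (n + 1) := by
  induction n with
  | zero => rw [convPow, zero_add, pow_one]
  | succ n ih => rw [convPow, op_conv, ih, ← pow_succ']

theorem op_inv_conjInv (ν : Measure G) [IsFiniteMeasureOnCompacts ν] (f : C_c(G, ℂ)) :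
    π.op ν.inv (conjInv f) = star (π.op ν f) := by
  rw [ContinuousLinearMap.star_eq_adjoint, ContinuousLinearMap.eq_adjoint_iff]
  intro v w
  have hinv : ∫ g, inner ℂ w (conjInv f g • (π.toHom g : H →L[ℂ] H) v) ∂ν.inv =
      ∫ g, inner ℂ w (conjInv f g⁻¹ • (π.toHom g⁻¹ : H →L[ℂ] H) v) ∂ν :=
    (Homeomorph.inv G).measurableEmbedding.integral_map
      (fun g => inner ℂ w (conjInv f g • (π.toHom g : H →L[ℂ] H) v))
  have hunitary (g : G) : inner ℂ ((π.toHom g⁻¹ : H →L[ℂ] H) v) w =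
      inner ℂ v ((π.toHom g : H →L[ℂ] H) w) := by
    rw [← Unitary.inner_map_map (π.toHom g), ← mul_apply_eq_comp, ← Submonoid.coe_mul, ← map_mul]
    simp
  rw [← inner_conj_symm, op_apply, ← integral_inner (π.integrable_smul ν.inv _ v), hinv,
    ← integral_conj, op_apply, ← integral_inner (π.integrable_smul ν f w)]
  congr 1 with g
  rw [inner_conj_symm, inner_smul_left, inner_smul_right, hunitary, conjInv_apply, inv_inv,
    RCLike.star_def, Complex.conj_conj]

theorem op_conv_conjInv_self (ν : Measure G) [IsFiniteMeasureOnCompacts ν] [ν.IsMulLeftInvariant]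
    (f : C_c(G, ℂ)) : π.op ν (conv ν.inv (conjInv f) f) = star (π.op ν f) * π.op ν f := by
  rw [op_conv, op_inv_conjInv]

theorem isSelfAdjoint_op_conv_conjInv_self (ν : Measure G) [IsFiniteMeasureOnCompacts ν]
    [ν.IsMulLeftInvariant] (f : C_c(G, ℂ)) :
    IsSelfAdjoint (π.op ν (conv ν.inv (conjInv f) f)) := by
  rw [op_conv_conjInv_self]
  exact IsSelfAdjoint.star_mul_self _

theorem sqrt_norm_op_conv_conjInv_self (ν : Measure G) [IsFiniteMeasureOnCompacts ν]
    [ν.IsMulLeftInvariant] (f : C_c(G, ℂ)) :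
    √‖π.op ν (conv ν.inv (conjInv f) f)‖ = ‖π.op ν f‖ := by
  rw [op_conv_conjInv_self, CStarRing.norm_star_mul_self, Real.sqrt_mul_self (norm_nonneg _)]

end UnitaryRep

section CompactQuotient

variable {G : Type*} [Group G] [TopologicalSpace G] [IsTopologicalGroup G] [LocallyCompactSpace G]

theorem exists_isCompact_forall_mul_mem (Γ : Subgroup G) [CompactSpace (G ⧸ Γ)] :
    ∃ K : Set G, IsCompact K ∧ ∀ g : G, ∃ γ : Γ, g * γ ∈ K := by
  choose N hN hN' using fun g : G => exists_compact_mem_nhds g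
  have hU : ∀ x ∈ (Set.univ : Set (G ⧸ Γ)), ((↑) : G → G ⧸ Γ) '' N x.out ∈ 𝓝 x := fun x _ => by
    have := QuotientGroup.isOpenMap_coe.image_mem_nhds (hN' x.out) (f := ((↑) : G → G ⧸ Γ))
    rwa [QuotientGroup.out_eq'] at this
  obtain ⟨t, -, ht⟩ := isCompact_univ.elim_nhds_subcover _ hU
  refine ⟨⋃ x ∈ t, N x.out, t.isCompact_biUnion fun x _ => hN _, fun g => ?_⟩
  obtain ⟨x, hx, k, hk, hkg⟩ := Set.mem_iUnion₂.mp (ht (Set.mem_univ (g : G ⧸ Γ)))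
  refine ⟨⟨g⁻¹ * k, QuotientGroup.eq.mp hkg.symm⟩, Set.mem_iUnion₂.mpr ⟨x, hx, ?_⟩⟩
  simpa using hk

theorem exists_forall_norm_mul_le {K : Set G} (hK : IsCompact K) (u : C_c(G, ℂ)) :
    ∃ η : C_c(G, ℝ), ∀ g ∈ K, ∀ y, ‖u (g * y)‖ ≤ η y := by
  obtain ⟨M, hM⟩ := u.hasCompactSupport.exists_bound_of_continuous u.continuous
  obtain ⟨χ, hχ1, -, hχc, hχ⟩ := exists_continuous_one_zero_of_isCompact
    (hK.inv.mul u.hasCompactSupport.isCompact) isClosed_empty (Set.disjoint_empty _)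
  have hM0 : 0 ≤ M := (norm_nonneg _).trans (hM 1)
  refine ⟨⟨M • χ, hχc.smul_left (f := fun _ => M)⟩, fun g hg y => ?_⟩
  change ‖u (g * y)‖ ≤ M * χ y
  by_cases hy : g * y ∈ tsupport u
  · rw [hχ1 ⟨g⁻¹, Set.inv_mem_inv.mpr hg, g * y, hy, inv_mul_cancel_left g y⟩, Pi.one_apply,
      mul_one]
    exact hM _
  · rw [image_eq_zero_of_notMem_tsupport hy, norm_zero]
    exact mul_nonneg hM0 (hχ y).1

variable [MeasurableSpace G] [BorelSpace G] (ν : Measure G) [IsFiniteMeasureOnCompacts ν]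
  {Γ : Subgroup G}

omit [LocallyCompactSpace G] in
theorem integrable_mul_comp_inv_smul {η : G → ℝ} (hη : Continuous η) (hηc : HasCompactSupport η)
    (p : C(G ⧸ Γ, ℝ)) (x : G ⧸ Γ) : Integrable (fun y => η y * p (y⁻¹ • x)) ν :=
  Continuous.integrable_of_hasCompactSupport (by fun_prop) hηc.mul_right

variable [ν.IsMulLeftInvariant] [CompactSpace (G ⧸ Γ)]

theorem exists_integral_norm_mul_comp_inv_smul_le (u : C_c(G, ℂ)) :
    ∃ η : C_c(G, ℝ), ∀ p : C(G ⧸ Γ, ℝ), 0 ≤ p → ∀ x x' : G ⧸ Γ,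
      ∫ y, ‖u y‖ * p (y⁻¹ • x) ∂ν ≤ ∫ y, η y * p (y⁻¹ • x') ∂ν := by
  obtain ⟨K, hK, hKΓ⟩ := exists_isCompact_forall_mul_mem Γ
  have hrep (x : G ⧸ Γ) : ∃ k ∈ K, (k : G ⧸ Γ) = x := by
    induction x using QuotientGroup.induction_on with
    | H g => exact (hKΓ g).elim fun γ hγ => ⟨g * γ, hγ, by simp⟩
  obtain ⟨η, hη⟩ := exists_forall_norm_mul_le (hK.mul hK.inv) u
  refine ⟨η, fun p hp x x' => ?_⟩
  obtain ⟨k, hk, rfl⟩ := hrep x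
  obtain ⟨k', hk', rfl⟩ := hrep x'
  have hcancel (y : G) : (k * k'⁻¹ * y)⁻¹ • (k : G ⧸ Γ) = y⁻¹ • (k' : G ⧸ Γ) := by
    simp only [MulAction.Quotient.smul_coe, smul_eq_mul]
    group
  have hint := integrable_mul_comp_inv_smul ν u.continuous.norm u.hasCompactSupport.norm p
    (k : G ⧸ Γ)
  calc ∫ y, ‖u y‖ * p (y⁻¹ • (k : G ⧸ Γ)) ∂ν
      = ∫ y, ‖u (k * k'⁻¹ * y)‖ * p ((k * k'⁻¹ * y)⁻¹ • (k : G ⧸ Γ)) ∂ν :=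
        (integral_mul_left_eq_self (fun y => ‖u y‖ * p (y⁻¹ • (k : G ⧸ Γ))) (k * k'⁻¹)).symm
    _ ≤ ∫ y, η y * p (y⁻¹ • (k' : G ⧸ Γ)) ∂ν := by
        refine integral_mono (hint.comp_mul_left _)
          (integrable_mul_comp_inv_smul ν η.continuous η.hasCompactSupport p _) fun y => ?_
        dsimp only
        rw [hcancel]
        exact mul_le_mul_of_nonneg_right
          (hη _ (Set.mul_mem_mul hk (Set.inv_mem_inv.mpr hk')) y) (hp _)

variable [MeasurableSpace (G ⧸ Γ)] [BorelSpace (G ⧸ Γ)]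
  (μ : Measure (G ⧸ Γ)) [IsFiniteMeasure μ]

omit [LocallyCompactSpace G] [ν.IsMulLeftInvariant] in
theorem integral_integral_mul_comp_inv_smul [SMulInvariantMeasure G (G ⧸ Γ) μ] (η : C_c(G, ℝ))
    (p : C(G ⧸ Γ, ℝ)) :
    ∫ x, ∫ y, η y * p (y⁻¹ • x) ∂ν ∂μ = (∫ y, η y ∂ν) * ∫ x, p x ∂μ := by
  have hcont : Continuous (Function.uncurry fun (x : G ⧸ Γ) (y : G) => η y * p (y⁻¹ • x)) := by
    have := η.continuous
    simp only [Function.uncurry_def]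
    fun_prop
  have hsupp : HasCompactSupport
      (Function.uncurry fun (x : G ⧸ Γ) (y : G) => η y * p (y⁻¹ • x)) :=
    HasCompactSupport.intro' (isCompact_univ.prod η.hasCompactSupport.isCompact)
      (isClosed_univ.prod (isClosed_tsupport η)) fun z hz => by
      simp only [Function.uncurry_def]
      rw [image_eq_zero_of_notMem_tsupport fun h => hz ⟨Set.mem_univ _, h⟩, zero_mul]
  rw [integral_integral_swap_of_hasCompactSupport hcont hsupp]
  simp_rw [integral_const_mul, integral_smul_eq_self, integral_mul_const]

/- The left-hand side varies with `x` by at most a bounded factor, so it is comparable with its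
average over `x`, which is a multiple of `∫ p`. -/
theorem exists_integral_norm_mul_comp_inv_smul_le_mul_integral
    [SMulInvariantMeasure G (G ⧸ Γ) μ] [NeZero μ] (u : C_c(G, ℂ)) :
    ∃ C : ℝ, ∀ p : C(G ⧸ Γ, ℝ), 0 ≤ p → ∀ x : G ⧸ Γ,
      ∫ y, ‖u y‖ * p (y⁻¹ • x) ∂ν ≤ C * ∫ x, p x ∂μ := by
  obtain ⟨η, hη⟩ := exists_integral_norm_mul_comp_inv_smul_le ν u (Γ := Γ)
  refine ⟨(∫ y, η y ∂ν) / μ.real Set.univ, fun p hp x => ?_⟩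
  have hpos : 0 < μ.real Set.univ := by
    simp [measureReal_def, ENNReal.toReal_pos_iff, NeZero.ne μ]
  have hcont : Continuous fun x' : G ⧸ Γ => ∫ y, η y * p (y⁻¹ • x') ∂ν := by
    have := η.continuous
    rw [← continuousOn_univ]
    refine continuousOn_integral_of_compact_support (k := tsupport η) η.hasCompactSupport
      (Continuous.continuousOn ?_) fun x y _ hy => ?_
    · simp only [Function.uncurry_def]
      fun_prop
    · rw [image_eq_zero_of_notMem_tsupport hy, zero_mul]
  have hle := integral_mono (integrable_const (μ := μ) _)
    (hcont.integrable_of_hasCompactSupport (HasCompactSupport.of_compactSpace _)) (hη p hp x)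
  rw [integral_const, integral_integral_mul_comp_inv_smul, smul_eq_mul] at hle
  rwa [div_mul_eq_mul_div, le_div_iff₀' hpos]

end CompactQuotient

theorem integral_le_sqrt_mul_sqrt_integral_sq {X : Type*} [TopologicalSpace X] [CompactSpace X]
    [MeasurableSpace X] [BorelSpace X] (μ : Measure X) [IsFiniteMeasure μ] {p : C(X, ℝ)}
    (hp : 0 ≤ p) : ∫ x, p x ∂μ ≤ √(μ.real Set.univ) * √(∫ x, p x ^ 2 ∂μ) := by
  have hmem (q : C(X, ℝ)) : MemLp q (ENNReal.ofReal 2) μ :=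
    q.continuous.memLp_of_hasCompactSupport (HasCompactSupport.of_compactSpace _)
  have holder := integral_mul_le_Lp_mul_Lq_of_nonneg (μ := μ) Real.HolderConjugate.two_two
    (f := (1 : C(X, ℝ))) (g := p) (Eventually.of_forall fun _ => zero_le_one)
    (Eventually.of_forall hp) (hmem 1) (hmem p)
  simpa [Real.sqrt_eq_rpow] using holder

namespace IndPre

section FiberNorm

variable {G : Type*} [Group G] [TopologicalSpace G] {Γ : Subgroup G} [MeasurableSpace (G ⧸ Γ)]
  {μ : Measure (G ⧸ Γ)} {V : Type*} [NormedAddCommGroup V] [InnerProductSpace ℂ V]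
  [CompleteSpace V] {ρ : Γ →* unitary (V →L[ℂ] V)}

/-- The continuous function `gΓ ↦ ‖φ(g)‖` on `G ⧸ Γ`, for an equivariant map `φ`. -/
def fiberNorm (φ : IndPre Γ μ ρ) : C(G ⧸ Γ, ℝ) where
  toFun x := √(fiberInner φ φ x).re
  continuous_toFun := (Complex.continuous_re.comp (continuous_fiberInner φ φ)).sqrt

theorem fiberNorm_mk (φ : IndPre Γ μ ρ) (g : G) : fiberNorm φ (g : G ⧸ Γ) = ‖φ.toMap g‖ :=
  (norm_eq_sqrt_re_inner (𝕜 := ℂ) (φ.toMap g)).symm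

theorem fiberNorm_nonneg (φ : IndPre Γ μ ρ) : 0 ≤ fiberNorm φ := fun _ => Real.sqrt_nonneg _

variable [CompactSpace (G ⧸ Γ)] [BorelSpace (G ⧸ Γ)] [IsFiniteMeasure μ]

theorem integral_fiberNorm_sq (φ : IndPre Γ μ ρ) : ∫ x, fiberNorm φ x ^ 2 ∂μ = ‖φ‖ ^ 2 := by
  have hsq (x : G ⧸ Γ) : fiberNorm φ x ^ 2 = RCLike.re (fiberInner φ φ x) := by
    induction x using QuotientGroup.induction_on with
    | H g => rw [fiberNorm_mk, fiberInner_mk, inner_self_eq_norm_sq]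
  simp_rw [hsq]
  rw [integral_re (integrable_fiberInner φ φ), ← inner_def, inner_self_eq_norm_sq]

theorem integral_fiberNorm_le (φ : IndPre Γ μ ρ) :
    ∫ x, fiberNorm φ x ∂μ ≤ √(μ.real Set.univ) * ‖φ‖ := by
  simpa only [integral_fiberNorm_sq, Real.sqrt_sq (norm_nonneg φ)] using
    integral_le_sqrt_mul_sqrt_integral_sq μ (fiberNorm_nonneg φ)

end FiberNorm

universe u

theorem exists_integral_norm_mul_fiberNorm_le {G : Type*} [Group G] [TopologicalSpace G]
    [IsTopologicalGroup G] [LocallyCompactSpace G] [MeasurableSpace G] [BorelSpace G]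
    (ν : Measure G) [IsFiniteMeasureOnCompacts ν] [ν.IsMulLeftInvariant] {Γ : Subgroup G}
    [CompactSpace (G ⧸ Γ)] [MeasurableSpace (G ⧸ Γ)] [BorelSpace (G ⧸ Γ)] (μ : Measure (G ⧸ Γ))
    [IsFiniteMeasure μ] [SMulInvariantMeasure G (G ⧸ Γ) μ] [NeZero μ] (u : C_c(G, ℂ)) :
    ∃ C : ℝ, 0 ≤ C ∧ ∀ (V : Type u) [NormedAddCommGroup V] [InnerProductSpace ℂ V]
      [CompleteSpace V] (ρ : Γ →* unitary (V →L[ℂ] V)) (φ : IndPre Γ μ ρ) (x : G ⧸ Γ),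
      ∫ y, ‖u y‖ * fiberNorm φ (y⁻¹ • x) ∂ν ≤ C * ‖φ‖ := by
  obtain ⟨C, hC⟩ := exists_integral_norm_mul_comp_inv_smul_le_mul_integral ν μ u
  refine ⟨|C| * √(μ.real Set.univ), by positivity, fun V _ _ _ ρ φ x => ?_⟩
  calc ∫ y, ‖u y‖ * fiberNorm φ (y⁻¹ • x) ∂ν
      ≤ C * ∫ x, fiberNorm φ x ∂μ := hC _ (fiberNorm_nonneg φ) x
    _ ≤ |C| * ∫ x, fiberNorm φ x ∂μ :=
        mul_le_mul_of_nonneg_right (le_abs_self C) (integral_nonneg (fiberNorm_nonneg φ))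
    _ ≤ |C| * (√(μ.real Set.univ) * ‖φ‖) :=
        mul_le_mul_of_nonneg_left (integral_fiberNorm_le φ) (abs_nonneg C)
    _ = |C| * √(μ.real Set.univ) * ‖φ‖ := (mul_assoc _ _ _).symm

section Smear

variable {G : Type*} [Group G] [TopologicalSpace G] [IsTopologicalGroup G] [MeasurableSpace G]
  [BorelSpace G] {Γ : Subgroup G} [MeasurableSpace (G ⧸ Γ)] {μ : Measure (G ⧸ Γ)}
  {V : Type*} [NormedAddCommGroup V] [InnerProductSpace ℂ V] [CompleteSpace V]
  {ρ : Γ →* unitary (V →L[ℂ] V)} (σ : Measure G) [IsFiniteMeasureOnCompacts σ] (f : C_c(G, ℂ))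

/-- Convolution by `f`, as an operator on equivariant maps. -/
def smear (φ : IndPre Γ μ ρ) : IndPre Γ μ ρ :=
  mk (StrongInduction.smear σ f φ.toMap) fun h γ => by
    rw [smear_apply, smear_apply,
      ← ContinuousLinearMap.integral_comp_comm _ (integrable_smul_comp_inv_mul σ f φ.toMap h)]
    congr 1 with y
    rw [map_smul, ← mul_assoc, toMap_mul]

theorem smear_toMap (φ : IndPre Γ μ ρ) :
    (smear σ f φ).toMap = StrongInduction.smear σ f φ.toMap := rfl

theorem norm_smear_toMap_le (φ : IndPre Γ μ ρ) (h : G) :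
    ‖(smear σ f φ).toMap h‖ ≤ ∫ y, ‖f y‖ * fiberNorm φ (y⁻¹ • (h : G ⧸ Γ)) ∂σ := by
  rw [smear_toMap, smear_apply]
  refine (norm_integral_le_integral_norm _).trans_eq ?_
  congr 1 with y
  rw [norm_smul, MulAction.Quotient.smul_coe, fiberNorm_mk, smul_eq_mul]

variable [CompactSpace (G ⧸ Γ)] [BorelSpace (G ⧸ Γ)] [IsFiniteMeasure μ]
  [SMulInvariantMeasure G (G ⧸ Γ) μ]

theorem fiberInner_smear (φ ψ : IndPre Γ μ ρ) (x : G ⧸ Γ) :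
    fiberInner ψ (smear σ f φ) x = ∫ y, f y • fiberInner ψ (translate Γ μ ρ y φ) x ∂σ := by
  induction x using QuotientGroup.induction_on with
  | H g =>
    rw [fiberInner_mk, smear_toMap, smear_apply,
      ← integral_inner (integrable_smul_comp_inv_mul σ f φ.toMap g)]
    congr 1 with y
    rw [inner_smul_right, fiberInner_mk, translate_toMap, smul_eq_mul]

omit [MeasurableSpace G] [BorelSpace G] in
theorem continuous_uncurry_fiberInner_translate (φ ψ : IndPre Γ μ ρ) :
    Continuous fun z : G × (G ⧸ Γ) => fiberInner ψ (translate Γ μ ρ z.1 φ) z.2 := by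
  have hq : IsOpenQuotientMap (Prod.map id ((↑) : G → G ⧸ Γ) : G × G → G × (G ⧸ Γ)) :=
    IsOpenQuotientMap.id.prodMap QuotientGroup.isOpenQuotientMap_mk
  refine hq.isQuotientMap.continuous_iff.mpr ?_
  change Continuous fun z : G × G => inner ℂ (ψ.toMap z.2) (φ.toMap (z.1⁻¹ * z.2))
  fun_prop

theorem op_coe (φ : IndPre Γ μ ρ) :
    (Ind Γ μ ρ).op σ f (φ : IndSpace Γ μ ρ) = (smear σ f φ : IndPre Γ μ ρ) := by
  refine ext_inner_left ℂ fun w => ?_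
  induction w using UniformSpace.Completion.induction_on with
  | hp => exact isClosed_eq (by fun_prop) (by fun_prop)
  | ih ψ =>
    have hcont : Continuous (Function.uncurry fun y x =>
        f y • fiberInner ψ (translate Γ μ ρ y φ) x) :=
      (f.continuous.comp continuous_fst).smul (continuous_uncurry_fiberInner_translate φ ψ)
    have hsupp : HasCompactSupport (Function.uncurry fun y x =>
        f y • fiberInner ψ (translate Γ μ ρ y φ) x) :=
      HasCompactSupport.intro' (f.hasCompactSupport.isCompact.prod isCompact_univ)
        ((isClosed_tsupport f).prod isClosed_univ) fun z hz => by
        simp only [Function.uncurry_def]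
        rw [image_eq_zero_of_notMem_tsupport fun h => hz ⟨h, Set.mem_univ _⟩, zero_smul]
    rw [UnitaryRep.op_apply, ← integral_inner (UnitaryRep.integrable_smul σ _ f _),
      UniformSpace.Completion.inner_coe, inner_def]
    simp_rw [fiberInner_smear]
    rw [← integral_integral_swap_of_hasCompactSupport hcont hsupp]
    congr 1 with y
    rw [integral_smul, ← inner_def, Ind_apply_coe, inner_smul_right,
      UniformSpace.Completion.inner_coe, smul_eq_mul]

end Smear

end IndPre

section DiscreteSubgroup

theorem integral_smul_finsum {X ι E : Type*} [TopologicalSpace X] [MeasurableSpace X]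
    [OpensMeasurableSpace X] [NormedAddCommGroup E] [NormedSpace ℂ E] (σ : Measure X)
    [IsFiniteMeasureOnCompacts σ] (w : C_c(X, ℂ)) {F : ι → X → E} (hF : ∀ i, Continuous (F i))
    (hlf : LocallyFinite fun i => Function.support (F i)) :
    ∫ y, w y • ∑ᶠ i, F i y ∂σ = ∑ᶠ i, ∫ y, w y • F i y ∂σ := by
  have hfin := hlf.finite_nonempty_inter_compact w.hasCompactSupport
  have hzero (i : ι) (hi : i ∉ hfin.toFinset) (y : X) : w y • F i y = 0 := by
    by_contra hne
    exact hi (hfin.mem_toFinset.mpr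
      ⟨y, right_ne_zero_of_smul hne, subset_tsupport _ (left_ne_zero_of_smul hne)⟩)
  have hsum (y : X) : w y • ∑ᶠ i, F i y = ∑ i ∈ hfin.toFinset, w y • F i y := by
    rw [smul_finsum' _ (hlf.point_finite y)]
    exact finsum_eq_sum_of_support_subset _ fun i hi => by_contra fun h => hi (hzero i h y)
  have hint (i : ι) : Integrable (fun y => w y • F i y) σ :=
    (w.continuous.smul (hF i)).integrable_of_hasCompactSupport w.hasCompactSupport.smul_right
  simp_rw [hsum]
  rw [integral_finsetSum _ fun i _ => hint i]
  refine (finsum_eq_sum_of_support_subset _ fun i hi => by_contra fun h => hi ?_).symm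
  simp only [hzero i h, integral_zero]

variable {G : Type*} [Group G] [TopologicalSpace G] [IsTopologicalGroup G] [T2Space G]
  (Γ : Subgroup G) [DiscreteTopology Γ]

theorem finite_coe_mem_of_isCompact {Q : Set G} (hQ : IsCompact Q) :
    {γ : Γ | (γ : G) ∈ Q}.Finite := by
  have h := Γ.tendsto_coe_cofinite_of_discrete (isDiscrete_iff_discreteTopology.mpr inferInstance)
    hQ.compl_mem_cocompact
  rw [mem_map, mem_cofinite] at h
  exact h.subset fun γ hγ h' => h' hγ

variable [LocallyCompactSpace G]

theorem locallyFinite_support_mul_mul {E : Type*} [Zero E] {F : G → E}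
    (hF : HasCompactSupport F) :
    LocallyFinite fun γ : Γ => Function.support fun x : G × G => F (x.1 * γ * x.2) := by
  intro x
  obtain ⟨K, hK, hKx⟩ := exists_compact_mem_nhds x.1
  obtain ⟨L, hL, hLx⟩ := exists_compact_mem_nhds x.2
  refine ⟨K ×ˢ L, prod_mem_nhds hKx hLx,
    (finite_coe_mem_of_isCompact Γ ((hK.inv.mul hF.isCompact).mul hL.inv)).subset ?_⟩
  rintro γ ⟨⟨h, g⟩, hne, hh, hg⟩
  exact ⟨h⁻¹ * (h * γ * g), ⟨h⁻¹, Set.inv_mem_inv.mpr hh, _, subset_tsupport _ hne, rfl⟩, g⁻¹,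
    Set.inv_mem_inv.mpr hg, by group⟩

theorem locallyFinite_support_coe_mul {E : Type*} [Zero E] {F : G → E}
    (hF : HasCompactSupport F) :
    LocallyFinite fun γ : Γ => Function.support fun y : G => F (γ * y) := by
  have hpair : Continuous fun y : G => ((1 : G), y) := by fun_prop
  exact ((locallyFinite_support_mul_mul Γ hF).preimage_continuous hpair).subset
    fun γ y hy => by simpa using hy

theorem exists_finsum_coe_mul_eq_one [CompactSpace (G ⧸ Γ)] :
    ∃ w : C_c(G, ℂ), ∀ y, ∑ᶠ γ : Γ, w (γ * y) = 1 := by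
  obtain ⟨K, hK, hKΓ⟩ := exists_isCompact_forall_mul_mem Γ
  obtain ⟨η, hη1, -, hηc, hη⟩ := exists_continuous_one_zero_of_isCompact hK.inv
    isClosed_empty (Set.disjoint_empty _)
  have hlf := locallyFinite_support_coe_mul Γ hηc
  set s : G → ℝ := fun y => ∑ᶠ γ : Γ, η (γ * y)
  have hs : Continuous s := continuous_finsum (fun γ => by fun_prop) hlf
  have hpos (y : G) : 0 < s y := by
    obtain ⟨γ, hγ⟩ := hKΓ y⁻¹
    have hle : η ((γ⁻¹ : Γ) * y) ≤ s y :=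
      single_le_finsum γ⁻¹ (hlf.point_finite y) fun _ => (hη _).1
    rw [hη1 (by simpa using hγ)] at hle
    exact one_pos.trans_le hle
  have hinv (y : G) (γ : Γ) : s (γ * y) = s y := by
    change _ = ∑ᶠ γ' : Γ, η (γ' * y)
    rw [← finsum_comp_equiv (Equiv.mulRight γ)]
    simp [s, mul_assoc]
  have hsum (y : G) : ∑ᶠ γ : Γ, η (γ * y) * (s (γ * y))⁻¹ = 1 := by
    simp_rw [hinv]
    rw [← finsum_mul' _ _ (hlf.point_finite y)]
    exact mul_inv_cancel₀ (hpos y).ne'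
  have hfin (y : G) : (Function.support fun γ : Γ => η (γ * y) * (s (γ * y))⁻¹).Finite :=
    (hlf.point_finite y).subset fun γ hγ => left_ne_zero_of_mul hγ
  refine ⟨⟨⟨fun y => ((η y * (s y)⁻¹ : ℝ) : ℂ), Complex.continuous_ofReal.comp
    (η.continuous.mul (hs.inv₀ fun y => (hpos y).ne'))⟩,
    (hηc.mul_right (f' := fun y => (s y)⁻¹)).comp_left Complex.ofReal_zero⟩, fun y => ?_⟩
  change ∑ᶠ γ : Γ, Complex.ofRealHom (η (γ * y) * (s (γ * y))⁻¹) = 1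
  rw [← map_finsum _ (hfin y), hsum, map_one]

variable [MeasurableSpace G] [BorelSpace G] {E : Type*} [NormedAddCommGroup E] [NormedSpace ℂ E]

/- Insert `∑ᶠ γ, w (γ * y) = 1` and substitute `γ⁻¹ * y` for `y` in the `γ`-th summand. -/
theorem integral_smul_eq_integral_smul_finsum (ν : Measure G) [IsFiniteMeasureOnCompacts ν]
    [ν.IsMulLeftInvariant] {w : C_c(G, ℂ)} (hw : ∀ y, ∑ᶠ γ : Γ, w (γ * y) = 1) (f : C_c(G, ℂ))
    (φ : C(G, E)) :
    ∫ y, f y • φ y ∂ν = ∫ y, w y • ∑ᶠ γ : Γ, f (γ * y) • φ (γ * y) ∂ν := by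
  have hwlf := (locallyFinite_support_coe_mul Γ w.hasCompactSupport).comp_injective inv_injective
  have hflf := locallyFinite_support_coe_mul Γ f.hasCompactSupport
  have := w.continuous
  have := f.continuous
  calc ∫ y, f y • φ y ∂ν
      = ∫ y, f y • ∑ᶠ γ : Γ, w ((γ⁻¹ : Γ) * y) • φ y ∂ν := by
        congr 1 with y
        have hsum : ∑ᶠ γ : Γ, w ((γ⁻¹ : Γ) * y) = 1 :=
          (finsum_comp_equiv (Equiv.inv Γ)).trans (hw y)
        rw [← finsum_smul, hsum, one_smul]
    _ = ∑ᶠ γ : Γ, ∫ y, f y • w ((γ⁻¹ : Γ) * y) • φ y ∂ν :=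
        integral_smul_finsum ν f (fun γ => by fun_prop)
          (hwlf.subset fun γ y hy => left_ne_zero_of_smul hy)
    _ = ∑ᶠ γ : Γ, ∫ y, w y • f (γ * y) • φ (γ * y) ∂ν := by
        refine finsum_congr fun γ => ?_
        rw [← integral_mul_left_eq_self _ (γ : G)]
        simp only [InvMemClass.coe_inv, inv_mul_cancel_left, smul_comm (w _)]
    _ = ∫ y, w y • ∑ᶠ γ : Γ, f (γ * y) • φ (γ * y) ∂ν :=
        (integral_smul_finsum ν w (fun γ => by fun_prop)
          (hflf.subset fun γ y hy => left_ne_zero_of_smul hy)).symm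

end DiscreteSubgroup

section UniformConvergence

theorem tendstoUniformlyOn_of_equicontinuousAt {ι X α : Type*} [TopologicalSpace X] [UniformSpace α]
    {F : ι → X → α} {f : X → α} {l : Filter ι} {K : Set X} (hK : IsCompact K)
    (hF : ∀ x ∈ K, EquicontinuousAt F x) (hlim : ∀ x ∈ K, Tendsto (F · x) l (𝓝 (f x))) :
    TendstoUniformlyOn F f l K := by
  have hequi : EquicontinuousOn F K := fun x hx => (hF x hx).equicontinuousWithinAt K
  refine UniformOnFun.tendsto_iff_tendstoUniformlyOn.mp
    ((EquicontinuousOn.tendsto_uniformOnFun_iff_pi' (𝔖 := {K}) (by simpa using hK)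
      (by simpa using hequi) l f).mpr (tendsto_pi_nhds.mpr ?_)) K rfl
  rintro ⟨x, hx⟩
  exact hlim x (by simpa using hx)

theorem tendsto_iSup_of_tendstoUniformly {ι X : Type*} [Nonempty X] {F : ι → X → ℝ} {f : X → ℝ}
    {l : Filter ι} (h : TendstoUniformly F f l) (hF : ∀ i, BddAbove (Set.range (F i)))
    (hf : BddAbove (Set.range f)) : Tendsto (fun i => ⨆ x, F i x) l (𝓝 (⨆ x, f x)) := by
  refine Metric.tendsto_nhds.mpr fun ε hε => ?_
  filter_upwards [Metric.tendstoUniformly_iff.mp h (ε / 2) (half_pos hε)] with i hi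
  refine lt_of_le_of_lt ?_ (half_lt_self hε)
  rw [Real.dist_eq, abs_sub_le_iff, sub_le_iff_le_add, sub_le_iff_le_add]
  have hi' (x : X) := abs_sub_lt_iff.mp (hi x)
  exact ⟨ciSup_le fun x => by linarith [(hi' x).2, le_ciSup hf x],
    ciSup_le fun x => by linarith [(hi' x).1, le_ciSup (hF i) x]⟩

end UniformConvergence

section GroupAlgebra

variable {Γ : Type*} [Group Γ] {V : Type*} [NormedAddCommGroup V] [InnerProductSpace ℂ V]
  [CompleteSpace V] (ρ : Γ →* unitary (V →L[ℂ] V)) (z : MonoidAlgebra ℂ Γ)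

theorem groupAlgebraOp_apply (v : V) :
    groupAlgebraOp ρ z v = ∑ᶠ γ, z.coeff γ • (ρ γ : V →L[ℂ] V) v := by
  rw [groupAlgebraOp, MonoidAlgebra.lift_apply, Finsupp.sum, sum_apply]
  refine (finsum_eq_sum_of_support_subset _ fun γ hγ => ?_).symm
  simpa using left_ne_zero_of_smul hγ

theorem norm_groupAlgebraOp_le : ‖groupAlgebraOp ρ z‖ ≤ ∑ᶠ γ, ‖z.coeff γ‖ := by
  refine ContinuousLinearMap.opNorm_le_bound _ (finsum_nonneg fun _ => norm_nonneg _) fun v => ?_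
  rw [groupAlgebraOp, MonoidAlgebra.lift_apply, Finsupp.sum, sum_apply,
    finsum_eq_sum_of_support_subset (s := z.coeff.support) _ fun γ hγ => by simpa using hγ,
    Finset.sum_mul]
  refine norm_sum_le_of_le _ fun γ _ => ?_
  rw [smul_apply, norm_smul]
  exact (congrArg _ (Unitary.norm_map (ρ γ) v)).le

theorem groupAlgebraOp_single_one (γ : Γ) :
    groupAlgebraOp ρ (MonoidAlgebra.single γ 1) = (ρ γ : V →L[ℂ] V) := by
  rw [groupAlgebraOp, MonoidAlgebra.lift_single, one_smul]
  rfl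

theorem groupAlgebraOp_sub (w : MonoidAlgebra ℂ Γ) :
    groupAlgebraOp ρ (z - w) = groupAlgebraOp ρ z - groupAlgebraOp ρ w :=
  map_sub (MonoidAlgebra.lift ℂ (V →L[ℂ] V) Γ _) z w

theorem groupAlgebraOp_mul (w : MonoidAlgebra ℂ Γ) :
    groupAlgebraOp ρ (z * w) = groupAlgebraOp ρ z * groupAlgebraOp ρ w :=
  map_mul (MonoidAlgebra.lift ℂ (V →L[ℂ] V) Γ _) z w

end GroupAlgebra

section Kernel

variable {G : Type*} [Group G] [TopologicalSpace G] [IsTopologicalGroup G] [T2Space G]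
  [LocallyCompactSpace G] {Γ : Subgroup G} [DiscreteTopology Γ]

variable (Γ) in
/-- The element `∑ F(hγg) γ` of `ℂ[Γ]`, for `x = (h, g)`. Its image under `ρ` is the value at
`(h, g⁻¹)` of the integral kernel by which `F` acts on the representation induced from `ρ`. -/
def kernel (F : C_c(G, ℂ)) (x : G × G) : MonoidAlgebra ℂ Γ :=
  .ofCoeff (.ofSupportFinite (fun γ => F (x.1 * γ * x.2))
    ((locallyFinite_support_mul_mul Γ F.hasCompactSupport).point_finite x))

theorem coeff_kernel (F : C_c(G, ℂ)) (x : G × G) (γ : Γ) :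
    (kernel Γ F x).coeff γ = F (x.1 * γ * x.2) := rfl

theorem kernel_mul_coe (F : C_c(G, ℂ)) (h g : G) (γ δ : Γ) :
    kernel Γ F (h * γ, δ * g) =
      MonoidAlgebra.single γ⁻¹ 1 * kernel Γ F (h, g) * MonoidAlgebra.single δ⁻¹ 1 := by
  refine MonoidAlgebra.ext (Finsupp.ext fun η => ?_)
  simp [coeff_kernel, mul_assoc]

theorem tendsto_finsum_norm_sub_kernel (F : C_c(G, ℂ)) (x₀ : G × G) :
    Tendsto (fun x => ∑ᶠ γ : Γ, ‖(kernel Γ F x - kernel Γ F x₀).coeff γ‖) (𝓝 x₀) (𝓝 0) := by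
  have := F.continuous
  have hlf := locallyFinite_support_mul_mul Γ F.hasCompactSupport
  have hlf' : LocallyFinite fun γ : Γ =>
      Function.support fun x : G × G => ‖F (x.1 * γ * x.2) - F (x₀.1 * γ * x₀.2)‖ := fun x => by
    obtain ⟨U, hU, hfin⟩ := hlf x
    refine ⟨U, hU, (hfin.union (hlf.point_finite x₀)).subset ?_⟩
    rintro γ ⟨y, hy, hyU⟩
    by_contra hγ
    simp only [Set.mem_union, Set.mem_ofPred_eq, not_or] at hγ
    have h₀ : F (x₀.1 * γ * x₀.2) = 0 := Function.notMem_support.mp hγ.2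
    have hyγ : F (y.1 * γ * y.2) = 0 := Function.notMem_support.mp fun h => hγ.1 ⟨y, h, hyU⟩
    exact hy (by simp [h₀, hyγ])
  have hcont : Continuous fun x : G × G =>
      ∑ᶠ γ : Γ, ‖F (x.1 * γ * x.2) - F (x₀.1 * γ * x₀.2)‖ :=
    continuous_finsum (fun γ => by fun_prop) hlf'
  simpa [coeff_kernel] using hcont.tendsto x₀

variable {V : Type*} [NormedAddCommGroup V] [InnerProductSpace ℂ V] [CompleteSpace V]
  (ρ : Γ →* unitary (V →L[ℂ] V))

theorem groupAlgebraOp_kernel_apply (F : C_c(G, ℂ)) (x : G × G) (v : V) :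
    groupAlgebraOp ρ (kernel Γ F x) v =
      ∑ᶠ γ : Γ, F (x.1 * γ * x.2) • (ρ γ : V →L[ℂ] V) v :=
  groupAlgebraOp_apply ρ _ v

theorem norm_groupAlgebraOp_kernel_mul_coe (F : C_c(G, ℂ)) (h g : G) (γ δ : Γ) :
    ‖groupAlgebraOp ρ (kernel Γ F (h * γ, δ * g))‖ = ‖groupAlgebraOp ρ (kernel Γ F (h, g))‖ := by
  rw [kernel_mul_coe, groupAlgebraOp_mul, groupAlgebraOp_mul, groupAlgebraOp_single_one,
    groupAlgebraOp_single_one, CStarRing.norm_mul_coe_unitary, CStarRing.norm_coe_unitary_mul]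

theorem equicontinuousAt_norm_groupAlgebraOp_kernel {ι : Type*} {V : ι → Type*}
    [∀ i, NormedAddCommGroup (V i)] [∀ i, InnerProductSpace ℂ (V i)] [∀ i, CompleteSpace (V i)]
    (ρ : ∀ i, Γ →* unitary (V i →L[ℂ] V i)) (F : C_c(G, ℂ)) (x₀ : G × G) :
    EquicontinuousAt (fun i x => ‖groupAlgebraOp (ρ i) (kernel Γ F x)‖) x₀ := by
  refine Metric.equicontinuousAt_of_continuity_modulus _
    (tendsto_finsum_norm_sub_kernel (Γ := Γ) F x₀) _ (Eventually.of_forall fun x i => ?_)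
  rw [dist_comm, Real.dist_eq]
  refine (abs_norm_sub_norm_le _ _).trans ?_
  rw [← groupAlgebraOp_sub]
  exact norm_groupAlgebraOp_le _ _

omit [T2Space G] [DiscreteTopology Γ] in
variable (Γ) in
theorem exists_isCompact_forall_mul_coe_mem [CompactSpace (G ⧸ Γ)] :
    ∃ Q : Set (G × G), IsCompact Q ∧ ∀ h g : G, ∃ γ δ : Γ, (h * γ, δ * g) ∈ Q := by
  obtain ⟨K, hK, hKΓ⟩ := exists_isCompact_forall_mul_mem Γ
  refine ⟨K ×ˢ K⁻¹, hK.prod hK.inv, fun h g => ?_⟩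
  obtain ⟨γ, hγ⟩ := hKΓ h
  obtain ⟨δ, hδ⟩ := hKΓ g⁻¹
  exact ⟨γ, δ⁻¹, hγ, by simpa using hδ⟩

universe u

theorem exists_norm_groupAlgebraOp_kernel_le [CompactSpace (G ⧸ Γ)] (F : C_c(G, ℂ)) :
    ∃ C : ℝ, 0 ≤ C ∧ ∀ (V : Type u) [NormedAddCommGroup V] [InnerProductSpace ℂ V]
      [CompleteSpace V] (ρ : Γ →* unitary (V →L[ℂ] V)) (x : G × G),
      ‖groupAlgebraOp ρ (kernel Γ F x)‖ ≤ C := by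
  have := F.continuous
  have hcont : Continuous fun x : G × G => ∑ᶠ γ : Γ, ‖F (x.1 * γ * x.2)‖ :=
    continuous_finsum (fun γ => by fun_prop) <|
      locallyFinite_support_mul_mul Γ F.hasCompactSupport.norm
  obtain ⟨Q, hQ, hQΓ⟩ := exists_isCompact_forall_mul_coe_mem Γ
  obtain ⟨C, hC⟩ := hQ.exists_bound_of_continuousOn hcont.continuousOn
  refine ⟨|C|, abs_nonneg C, fun V _ _ _ ρ ⟨h, g⟩ => ?_⟩
  obtain ⟨γ, δ, hQ⟩ := hQΓ h g
  calc ‖groupAlgebraOp ρ (kernel Γ F (h, g))‖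
      = ‖groupAlgebraOp ρ (kernel Γ F (h * γ, δ * g))‖ :=
        (norm_groupAlgebraOp_kernel_mul_coe ρ F h g γ δ).symm
    _ ≤ ∑ᶠ η : Γ, ‖F (h * γ * η * (δ * g))‖ := norm_groupAlgebraOp_le ρ _
    _ ≤ |C| := (le_abs_self _).trans ((hC _ hQ).trans (le_abs_self C))

/-- The supremum over `G × G` of the norms of the operators `ρ(kernel Γ F x)`. -/
def kernelNorm (F : C_c(G, ℂ)) : ℝ := ⨆ x : G × G, ‖groupAlgebraOp ρ (kernel Γ F x)‖

theorem kernelNorm_nonneg (F : C_c(G, ℂ)) : 0 ≤ kernelNorm ρ F :=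
  Real.iSup_nonneg fun _ => norm_nonneg _

variable [CompactSpace (G ⧸ Γ)]

theorem bddAbove_norm_groupAlgebraOp_kernel (F : C_c(G, ℂ)) :
    BddAbove (Set.range fun x : G × G => ‖groupAlgebraOp ρ (kernel Γ F x)‖) := by
  obtain ⟨C, -, hC⟩ := exists_norm_groupAlgebraOp_kernel_le (Γ := Γ) F
  exact ⟨C, Set.forall_mem_range.mpr fun x => hC _ ρ x⟩

theorem norm_groupAlgebraOp_kernel_le_kernelNorm (F : C_c(G, ℂ)) (x : G × G) :
    ‖groupAlgebraOp ρ (kernel Γ F x)‖ ≤ kernelNorm ρ F :=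
  le_ciSup (bddAbove_norm_groupAlgebraOp_kernel ρ F) x

theorem StronglyConverges.tendsto_kernelNorm {V : ℕ → Type*} [∀ i, NormedAddCommGroup (V i)]
    [∀ i, InnerProductSpace ℂ (V i)] [∀ i, CompleteSpace (V i)]
    {W : Type*} [NormedAddCommGroup W] [InnerProductSpace ℂ W] [CompleteSpace W]
    {ρ : ∀ i, Γ →* unitary (V i →L[ℂ] V i)} {ρinf : Γ →* unitary (W →L[ℂ] W)}
    (hρ : StronglyConverges ρ ρinf) (F : C_c(G, ℂ)) :
    Tendsto (fun i => kernelNorm (ρ i) F) atTop (𝓝 (kernelNorm ρinf F)) := by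
  obtain ⟨Q, hQ, hQΓ⟩ := exists_isCompact_forall_mul_coe_mem Γ
  have hunif : TendstoUniformlyOn (fun i x => ‖groupAlgebraOp (ρ i) (kernel Γ F x)‖)
      (fun x => ‖groupAlgebraOp ρinf (kernel Γ F x)‖) atTop Q :=
    tendstoUniformlyOn_of_equicontinuousAt hQ
      (fun x _ => equicontinuousAt_norm_groupAlgebraOp_kernel ρ F x) fun x _ => hρ (kernel Γ F x)
  refine tendsto_iSup_of_tendstoUniformly (Metric.tendstoUniformly_iff.mpr fun ε hε => ?_)
    (fun i => bddAbove_norm_groupAlgebraOp_kernel (ρ i) F)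
    (bddAbove_norm_groupAlgebraOp_kernel ρinf F)
  filter_upwards [Metric.tendstoUniformlyOn_iff.mp hunif ε hε] with i hi ⟨h, g⟩
  obtain ⟨γ, δ, hmem⟩ := hQΓ h g
  simpa only [norm_groupAlgebraOp_kernel_mul_coe] using hi _ hmem

end Kernel

section Sandwich

namespace IndPre

variable {G : Type*} [Group G] [TopologicalSpace G] [IsTopologicalGroup G] [T2Space G]
  [LocallyCompactSpace G] {Γ : Subgroup G} [DiscreteTopology Γ] [MeasurableSpace (G ⧸ Γ)]
  {μ : Measure (G ⧸ Γ)} {V : Type*} [NormedAddCommGroup V] [InnerProductSpace ℂ V]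
  [CompleteSpace V] {ρ : Γ →* unitary (V →L[ℂ] V)}

variable (μ ρ) in
/-- The equivariant map `h ↦ ∑ u(hγg) ρ(γ)v`, obtained by averaging the translate of `u` by `g`
over `Γ`. -/
def avg (u : C_c(G, ℂ)) (g : G) (v : V) : IndPre Γ μ ρ :=
  mk ⟨fun h => groupAlgebraOp ρ (kernel Γ u (h, g)) v, by
    have := u.continuous
    have hpair : Continuous fun h : G => (h, g) := by fun_prop
    have hlf := (locallyFinite_support_mul_mul Γ u.hasCompactSupport).preimage_continuous hpair
    simp_rw [groupAlgebraOp_kernel_apply]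
    exact continuous_finsum (fun γ => by fun_prop)
      (hlf.subset fun γ h hh => left_ne_zero_of_smul hh)⟩ fun h γ => by
    have hker := kernel_mul_coe u h g γ (1 : Γ)
    rw [OneMemClass.coe_one, one_mul, inv_one, ← MonoidAlgebra.one_def, mul_one] at hker
    change groupAlgebraOp ρ (kernel Γ u (h * γ, g)) v = _
    rw [hker, groupAlgebraOp_mul, groupAlgebraOp_single_one]
    rfl

theorem avg_toMap (u : C_c(G, ℂ)) (g : G) (v : V) (h : G) :
    (avg μ ρ u g v).toMap h = groupAlgebraOp ρ (kernel Γ u (h, g)) v := rfl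

theorem smear_avg [MeasurableSpace G] [BorelSpace G] (σ : Measure G) [IsFiniteMeasureOnCompacts σ]
    (f u : C_c(G, ℂ)) (g : G) (v : V) :
    smear σ f (avg μ ρ u g v) = avg μ ρ (conv σ f u) g v := by
  refine ext fun h => ?_
  have := u.continuous
  have hpair : Continuous fun y : G => (y⁻¹ * h, g) := by fun_prop
  have hlf := (locallyFinite_support_mul_mul Γ u.hasCompactSupport).preimage_continuous hpair
  calc (smear σ f (avg μ ρ u g v)).toMap h
      = ∫ y, f y • ∑ᶠ γ : Γ, u (y⁻¹ * h * γ * g) • (ρ γ : V →L[ℂ] V) v ∂σ := by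
        simp_rw [smear_toMap, smear_apply, avg_toMap, groupAlgebraOp_kernel_apply]
    _ = ∑ᶠ γ : Γ, ∫ y, f y • u (y⁻¹ * h * γ * g) • (ρ γ : V →L[ℂ] V) v ∂σ :=
        integral_smul_finsum σ f (fun γ => by fun_prop)
          (hlf.subset fun γ y hy => left_ne_zero_of_smul hy)
    _ = (avg μ ρ (conv σ f u) g v).toMap h := by
        rw [avg_toMap, groupAlgebraOp_kernel_apply]
        simp_rw [conv_apply, ← integral_smul_const, smul_smul, smul_eq_mul, mul_assoc]

theorem smear_toMap_eq_integral [MeasurableSpace G] [BorelSpace G] (ν : Measure G)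
    [IsFiniteMeasureOnCompacts ν] [ν.IsMulLeftInvariant] {w : C_c(G, ℂ)}
    (hw : ∀ y, ∑ᶠ γ : Γ, w (γ * y) = 1) (F : C_c(G, ℂ)) (φ : IndPre Γ μ ρ) (h : G) :
    (smear ν F φ).toMap h =
      ∫ y, w y • groupAlgebraOp ρ (kernel Γ F (h, y)) (φ.toMap y⁻¹) ∂ν := by
  have hφ (γ : Γ) (y : G) : φ.toMap (γ * y)⁻¹ = (ρ γ : V →L[ℂ] V) (φ.toMap y⁻¹) := by
    simpa using toMap_mul φ y⁻¹ γ⁻¹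
  let Fh : C_c(G, ℂ) := ⟨⟨fun y => F (h * y), F.continuous.comp (continuous_const_mul h)⟩,
    F.hasCompactSupport.comp_homeomorph (Homeomorph.mulLeft h)⟩
  let φinv : C(G, V) := ⟨fun y => φ.toMap y⁻¹, φ.toMap.continuous.comp continuous_inv⟩
  calc (smear ν F φ).toMap h
      = ∫ y, F (h * y) • φ.toMap y⁻¹ ∂ν := by
        rw [smear_toMap, smear_apply, ← integral_mul_left_eq_self _ h]
        simp only [mul_inv_rev, inv_mul_cancel_right]
    _ = ∫ y, w y • ∑ᶠ γ : Γ, F (h * (γ * y)) • φ.toMap (γ * y)⁻¹ ∂ν :=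
        integral_smul_eq_integral_smul_finsum Γ ν hw Fh φinv
    _ = ∫ y, w y • groupAlgebraOp ρ (kernel Γ F (h, y)) (φ.toMap y⁻¹) ∂ν := by
        simp_rw [groupAlgebraOp_kernel_apply, hφ, mul_assoc]

end IndPre

variable {G : Type*} [Group G] [TopologicalSpace G] [IsTopologicalGroup G] [T2Space G]
  [LocallyCompactSpace G] [MeasurableSpace G] [BorelSpace G] (ν : Measure G)
  [IsFiniteMeasureOnCompacts ν] [ν.IsMulLeftInvariant] {Γ : Subgroup G} [DiscreteTopology Γ]
  [CompactSpace (G ⧸ Γ)] [MeasurableSpace (G ⧸ Γ)] [BorelSpace (G ⧸ Γ)] (μ : Measure (G ⧸ Γ))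
  [IsFiniteMeasure μ] [SMulInvariantMeasure G (G ⧸ Γ) μ] [NeZero μ]

universe u

theorem exists_norm_op_le_mul_kernelNorm :
    ∃ C : ℝ, 0 ≤ C ∧ ∀ (V : Type u) [NormedAddCommGroup V] [InnerProductSpace ℂ V]
      [CompleteSpace V] (ρ : Γ →* unitary (V →L[ℂ] V)) (F : C_c(G, ℂ)),
      ‖(Ind Γ μ ρ).op ν F‖ ≤ C * kernelNorm ρ F := by
  obtain ⟨w, hw⟩ := exists_finsum_coe_mul_eq_one Γ
  obtain ⟨C, hC0, hC⟩ := IndPre.exists_integral_norm_mul_fiberNorm_le.{u} ν μ w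
  refine ⟨√(μ.real Set.univ) * C, by positivity, fun V _ _ _ ρ F => ?_⟩
  have hN := kernelNorm_nonneg ρ F
  refine ContinuousLinearMap.opNorm_le_bound _ (by positivity) fun ξ => ?_
  induction ξ using UniformSpace.Completion.induction_on with
  | hp => exact isClosed_le (by fun_prop) (by fun_prop)
  | ih φ =>
    rw [IndPre.op_coe, UniformSpace.Completion.norm_coe, UniformSpace.Completion.norm_coe]
    have hpoint (h : G) : ‖(IndPre.smear ν F φ).toMap h‖ ≤ kernelNorm ρ F * (C * ‖φ‖) := by
      rw [IndPre.smear_toMap_eq_integral ν hw]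
      have hint := integrable_mul_comp_inv_smul ν w.continuous.norm w.hasCompactSupport.norm
        (IndPre.fiberNorm φ) ((1 : G) : G ⧸ Γ)
      refine (norm_integral_le_of_norm_le (hint.const_mul (kernelNorm ρ F))
        (Eventually.of_forall fun y => ?_)).trans ?_
      · rw [norm_smul, MulAction.Quotient.smul_coe, smul_eq_mul, mul_one, IndPre.fiberNorm_mk,
          mul_left_comm]
        exact mul_le_mul_of_nonneg_left (ContinuousLinearMap.le_of_opNorm_le _
          (norm_groupAlgebraOp_kernel_le_kernelNorm ρ F (h, y)) _) (norm_nonneg _)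
      · rw [integral_const_mul]
        exact mul_le_mul_of_nonneg_left (hC V ρ φ _) hN
    calc ‖IndPre.smear ν F φ‖ ≤ kernelNorm ρ F * (C * ‖φ‖) * √(μ.real Set.univ) :=
          IndPre.norm_le_of_forall _ (by positivity) hpoint
      _ = √(μ.real Set.univ) * C * kernelNorm ρ F * ‖φ‖ := by ring

theorem exists_kernelNorm_conv_conv_le (f u : C_c(G, ℂ)) :
    ∃ D : ℝ, 0 ≤ D ∧ ∀ (V : Type u) [NormedAddCommGroup V] [InnerProductSpace ℂ V]
      [CompleteSpace V] (ρ : Γ →* unitary (V →L[ℂ] V)) (F : C_c(G, ℂ)),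
      kernelNorm ρ (conv ν f (conv ν F u)) ≤ D * ‖(Ind Γ μ ρ).op ν F‖ := by
  obtain ⟨C, hC0, hC⟩ := IndPre.exists_integral_norm_mul_fiberNorm_le.{u} ν μ f
  obtain ⟨B, hB0, hB⟩ := exists_norm_groupAlgebraOp_kernel_le.{u} (Γ := Γ) u
  refine ⟨C * (B * √(μ.real Set.univ)), by positivity, fun V _ _ _ ρ F => ciSup_le fun ⟨h, g⟩ =>
    ContinuousLinearMap.opNorm_le_bound _ (by positivity) fun v => ?_⟩
  have havg : ‖IndPre.avg μ ρ u g v‖ ≤ B * ‖v‖ * √(μ.real Set.univ) :=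
    IndPre.norm_le_of_forall _ (by positivity) fun h =>
      ContinuousLinearMap.le_of_opNorm_le _ (hB V ρ (h, g)) v
  calc ‖groupAlgebraOp ρ (kernel Γ (conv ν f (conv ν F u)) (h, g)) v‖
      = ‖(IndPre.smear ν f (IndPre.smear ν F (IndPre.avg μ ρ u g v))).toMap h‖ := by
        rw [IndPre.smear_avg, IndPre.smear_avg, IndPre.avg_toMap]
    _ ≤ C * ‖IndPre.smear ν F (IndPre.avg μ ρ u g v)‖ :=
        (IndPre.norm_smear_toMap_le ν f _ h).trans (hC V ρ _ _)
    _ = C * ‖(Ind Γ μ ρ).op ν F (IndPre.avg μ ρ u g v : IndPre Γ μ ρ)‖ := by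
        rw [IndPre.op_coe, UniformSpace.Completion.norm_coe]
    _ ≤ C * (‖(Ind Γ μ ρ).op ν F‖ * ‖IndPre.avg μ ρ u g v‖) := by
        rw [← UniformSpace.Completion.norm_coe (IndPre.avg μ ρ u g v)]
        exact mul_le_mul_of_nonneg_left (ContinuousLinearMap.le_opNorm _ _) hC0
    _ ≤ C * (‖(Ind Γ μ ρ).op ν F‖ * (B * ‖v‖ * √(μ.real Set.univ))) := by gcongr
    _ = C * (B * √(μ.real Set.univ)) * ‖(Ind Γ μ ρ).op ν F‖ * ‖v‖ := by ring

theorem exists_pow_norm_op_le_mul_kernelNorm_le (g : C_c(G, ℂ)) :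
    ∃ C D : ℝ, 0 ≤ C ∧ 0 ≤ D ∧ ∀ (V : Type u) [NormedAddCommGroup V] [InnerProductSpace ℂ V]
      [CompleteSpace V] (ρ : Γ →* unitary (V →L[ℂ] V)), IsSelfAdjoint ((Ind Γ μ ρ).op ν g) →
      ∀ n, ‖(Ind Γ μ ρ).op ν g‖ ^ (n + 3) ≤
          C * kernelNorm ρ (conv ν g (conv ν (convPow ν g n) g)) ∧
        kernelNorm ρ (conv ν g (conv ν (convPow ν g n) g)) ≤
          D * ‖(Ind Γ μ ρ).op ν g‖ ^ (n + 1) := by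
  obtain ⟨C, hC0, hC⟩ := exists_norm_op_le_mul_kernelNorm.{u} ν (Γ := Γ) μ
  obtain ⟨D, hD0, hD⟩ := exists_kernelNorm_conv_conv_le.{u} ν (Γ := Γ) μ g g
  refine ⟨C, D, hC0, hD0, fun V _ _ _ ρ hsa n => ⟨?_, ?_⟩⟩
  · have hop : (Ind Γ μ ρ).op ν (conv ν g (conv ν (convPow ν g n) g)) =
        (Ind Γ μ ρ).op ν g ^ (n + 3) := by
      rw [UnitaryRep.op_conv, UnitaryRep.op_conv, UnitaryRep.op_convPow, ← pow_succ, ← pow_succ']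
    rw [← norm_pow_of_isSelfAdjoint hsa (Nat.succ_ne_zero _), ← hop]
    exact hC V ρ _
  · rw [← norm_pow_of_isSelfAdjoint hsa (Nat.succ_ne_zero _), ← UnitaryRep.op_convPow]
    exact hD V ρ _

theorem StronglyConverges.tendsto_norm_op_of_isSelfAdjoint {V : ℕ → Type*}
    [∀ i, NormedAddCommGroup (V i)] [∀ i, InnerProductSpace ℂ (V i)] [∀ i, CompleteSpace (V i)]
    {W : Type*} [NormedAddCommGroup W] [InnerProductSpace ℂ W] [CompleteSpace W]
    {ρ : ∀ i, Γ →* unitary (V i →L[ℂ] V i)} {ρinf : Γ →* unitary (W →L[ℂ] W)}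
    (hρ : StronglyConverges ρ ρinf) {g : C_c(G, ℂ)}
    (hg : ∀ i, IsSelfAdjoint ((Ind Γ μ (ρ i)).op ν g))
    (hg' : IsSelfAdjoint ((Ind Γ μ ρinf).op ν g)) :
    Tendsto (fun i => ‖(Ind Γ μ (ρ i)).op ν g‖) atTop (𝓝 ‖(Ind Γ μ ρinf).op ν g‖) := by
  obtain ⟨C, D, hC, hD, hCD⟩ := exists_pow_norm_op_le_mul_kernelNorm_le ν (Γ := Γ) μ g
  obtain ⟨C', D', hC', -, hCD'⟩ := exists_pow_norm_op_le_mul_kernelNorm_le ν (Γ := Γ) μ g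
  exact tendsto_of_pow_le_of_le_pow (fun i => norm_nonneg _) (norm_nonneg _) hC hD hC'
    (fun n => hρ.tendsto_kernelNorm _)
    (fun n i => (hCD (V i) (ρ i) (hg i) n).1) (fun n i => (hCD (V i) (ρ i) (hg i) n).2)
    (fun n => (hCD' W ρinf hg' n).1) fun n => (hCD' W ρinf hg' n).2

end Sandwich

end StrongInduction

end

theorem mainTheorem2
    {G : Type*} [Group G] [TopologicalSpace G] [IsTopologicalGroup G]
    [LocallyCompactSpace G] [T2Space G] [MeasurableSpace G] [BorelSpace G]
    (ν : MeasureTheory.Measure G) [ν.IsHaarMeasure] [ν.Regular]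
    (Γ : Subgroup G) [DiscreteTopology Γ] [CompactSpace (G ⧸ Γ)]
    [MeasurableSpace (G ⧸ Γ)] [BorelSpace (G ⧸ Γ)]
    (μ : MeasureTheory.Measure (G ⧸ Γ)) [MeasureTheory.SMulInvariantMeasure G (G ⧸ Γ) μ]
    [MeasureTheory.IsFiniteMeasure μ] [μ.Regular] [NeZero μ]
    {V : ℕ → Type*} [∀ i, NormedAddCommGroup (V i)] [∀ i, InnerProductSpace ℂ (V i)]
    [∀ i, CompleteSpace (V i)]
    {W : Type*} [NormedAddCommGroup W] [InnerProductSpace ℂ W] [CompleteSpace W]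
    (ρ : ∀ i, Γ →* unitary (V i →L[ℂ] V i)) (ρinf : Γ →* unitary (W →L[ℂ] W))
    (h : StrongInduction.StronglyConverges ρ ρinf) :
    StrongInduction.UnitaryRep.StronglyConverges ν
      (fun i => StrongInduction.Ind Γ μ (ρ i)) (StrongInduction.Ind Γ μ ρinf) := by
  intro f
  have hsq := (h.tendsto_norm_op_of_isSelfAdjoint ν μ
    (fun i => (StrongInduction.Ind Γ μ (ρ i)).isSelfAdjoint_op_conv_conjInv_self ν f)
    ((StrongInduction.Ind Γ μ ρinf).isSelfAdjoint_op_conv_conjInv_self ν f)).sqrt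
  simpa only [StrongInduction.UnitaryRep.sqrt_norm_op_conv_conjInv_self] using hsq
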